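/- Let $a>0$ be real, let $\mu\in\mathbb C$ and let $I\subset\mathbb R$ be an interval. Let $\eta_1,\eta_2:\mathbb R\to[-\infty,+\infty]$ be functions with $\eta_1(\xi)<\eta_2(\xi)$ for all $\xi\in\mathbb R$ such that the region $$R=\{x\in\mathbb C:\ \eta_1(\operatorname{Im}x)<\operatorname{Re}x<\eta_2(\operatorname{Im}x)\}$$ is open (as is the case, for example, when the bounding curves are continuous and piecewise smooth), and suppose that $R$ is $a$-wide on $I$, that is, $\eta_2(\xi)-\eta_1(\xi)>a$ for all $\xi\in I$. Let $f$ be analytic in $R$ and satisfy the differential-difference equation $$[f(x)+f(x+a)]'+f^2(x)-f^2(x+a)=\mu$$ for all $x$ such that both $x\in R$ and $x+a\in R$. Then $f$ admits a meromorphic continuation to the strip $\{x\in\mathbb C:\operatorname{Im}x\in I\}$, and all its singularities there are first order poles: there is a function $F$ on $\mathbb C$ with $F=f$ on $R$ which is meromorphic at every point of the strip (that is, in a neighbourhood of every such point) and which, at each point of the strip where it is not analytic, has a pole of order exactly $1$. -/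

import Mathlib

open Complex

/-- The region of the complex plane lying strictly between the two curves `Re x = η₁ (Im x)` and
`Re x = η₂ (Im x)`. The values `±∞` of the boundary functions are allowed. -/
def curveRegion (η₁ η₂ : ℝ → EReal) : Set ℂ :=
  {x : ℂ | η₁ x.im < (x.re : EReal) ∧ (x.re : EReal) < η₂ x.im}

/-- `R` is a domain bounded by the curves `η₁ < η₂`: the set between them, and it is open.
(Continuous, in particular piecewise smooth, curves always give an open set. Since all horizontal
sections are non-empty intervals, `R` is then connected and simply connected.) -/
structure IsDomainBetween (R : Set ℂ) (η₁ η₂ : ℝ → EReal) : Prop where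
  lt : ∀ ξ : ℝ, η₁ ξ < η₂ ξ
  eq_region : R = curveRegion η₁ η₂
  isOpen : IsOpen R

/-- The domain `R` is `a`-wide on `I`: it lies between two curves `η₁ < η₂` whose horizontal
distance `η₂ ξ - η₁ ξ` is greater than `a` for all `ξ ∈ I`. -/
def IsWideDomainOn (a : ℝ) (I : Set ℝ) (R : Set ℂ) : Prop :=
  ∃ η₁ η₂ : ℝ → EReal, IsDomainBetween R η₁ η₂ ∧ ∀ ξ ∈ I, (a : EReal) < η₂ ξ - η₁ ξ

/-- `f` is an analytic solution in the open set `R` of the differential-difference equation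
`[f(x) + f(x+a)]' + f(x)² - f(x+a)² = μ`; the equation is required wherever both `x` and `x + a`
lie in `R`. -/
structure IsAnalyticDDESolution (a : ℝ) (μ : ℂ) (R : Set ℂ) (f : ℂ → ℂ) : Prop where
  analytic : AnalyticOnNhd ℂ f R
  equation : ∀ x : ℂ, x ∈ R → x + (a : ℂ) ∈ R →
    deriv (fun z : ℂ => f z + f (z + (a : ℂ))) x + f x ^ 2 - f (x + (a : ℂ)) ^ 2 = μ

/-! Put `U = f' + f² - μ`. The equation says that `g(x) = f(x + a)` solves the Riccati equation `g²
- g' = U`, that is, `g = -φ'/φ` with `φ'' = U φ`. On each horizontal line of the strip `f` is known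
along an interval longer than `a`, so this linear equation carries it further along the line. The
obstruction is a pole of `f`: there `U` is singular and `φ` might be multivalued.

The remedy is a class of germs stable under the step. If `f = n/t + h` with `n` an integer and `h(t)
+ h(-t) = O(t^(2|n|))` (`OddPolarAt`), then `U = m(m+1)/t² + w`, where the odd Taylor coefficients
of `w` of index below `2m` vanish (`OddPolarAt.trivialMonodromyAt`). This excludes logarithms in the
Frobenius method, so `φ` and `g` are meromorphic (`TrivialMonodromyAt.exists_continuation`), and `g`
is again of the first form (`TrivialMonodromyAt.oddPolarAt_of_riccati`). Analytic germs belong to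
the class with `n = 0`, and poles in the class are simple.

A supremum argument (`IsLineContinuation.exists_forall`) continues `f` along each line to the right,
and the reflection `x ↦ -x` to the left. Uniqueness along lines and compactness of segments glue the
germs into one function on the strip. -/

/-! ### Power series and the Frobenius method. -/

open Filter Topology in
theorem hasSum_deriv_of_eventually_hasSum {c : ℕ → ℂ} {P : ℂ → ℂ}
    (h : ∀ᶠ t in 𝓝 (0 : ℂ), HasSum (fun k => t ^ k * c k) (P t)) :
    AnalyticAt ℂ P 0 ∧
      ∀ᶠ t in 𝓝 (0 : ℂ), HasSum (fun k => t ^ k * ((k + 1 : ℕ) * c (k + 1))) (deriv P t) := by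
  have hp : HasFPowerSeriesAt P (FormalMultilinearSeries.ofScalars ℂ c) 0 := by
    rw [hasFPowerSeriesAt_iff]
    filter_upwards [h] with t ht
    simpa using ht
  refine ⟨hp.analyticAt, ?_⟩
  obtain ⟨r, hr⟩ := hp
  have hd := hr.fderiv
  filter_upwards [Metric.eball_mem_nhds (0 : ℂ) hd.r_pos] with t ht
  have h1 := hd.hasSum ht
  have h2 := h1.mapL (ContinuousLinearMap.apply ℂ ℂ (1 : ℂ))
  simp only [ContinuousLinearMap.apply_apply, zero_add, fderiv_apply_one_eq_deriv] at h2
  refine h2.congr_fun fun k => ?_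
  have h3 : (FormalMultilinearSeries.ofScalars ℂ c).derivSeries k (fun _ => t) =
      t ^ k • (FormalMultilinearSeries.ofScalars ℂ c).derivSeries k (fun _ => 1) := by
    simp
  rw [h3]
  change _ = t ^ k * ((FormalMultilinearSeries.ofScalars ℂ c).derivSeries k (fun _ => 1)) 1
  simp

/-- The recurrence can fail only at the resonant index `n = 1 - 2b`, which is odd. Below it the odd
`c n` vanish by parity, hence so does the right-hand side at resonance. -/
theorem exists_frobenius_coeff (b : ℤ) (w : ℕ → ℂ)
    (hodd : ∀ i : ℕ, Odd i → (i : ℤ) < -2 * b → w i = 0) :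
    ∃ c : ℕ → ℂ, c 0 = 1 ∧
      (∀ n : ℕ, n ≠ 0 → n * ‖c n‖ ≤ ‖∑ j ∈ Finset.range (n - 1), w (n - 2 - j) * c j‖) ∧
      ∀ n : ℕ, (n : ℂ) * (n - 1 + 2 * b) * c n =
        ∑ j ∈ Finset.range (n - 1), w (n - 2 - j) * c j := by
  -- At the resonant index the division by zero returns `0`, an admissible choice of the free
  -- coefficient.
  let F : (n : ℕ) → ((m : ℕ) → m < n → ℂ) → ℂ := fun n rec =>
    if n = 0 then 1 else
      (∑ j : Fin (n - 1), w (n - 2 - j) * rec j (by omega)) / ((n : ℂ) * (n - 1 + 2 * b))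
  let c : ℕ → ℂ := fun n => Nat.strongRec F n
  have hc : ∀ n, c n = if n = 0 then 1 else
      (∑ j ∈ Finset.range (n - 1), w (n - 2 - j) * c j) / ((n : ℂ) * (n - 1 + 2 * b)) := by
    intro n
    have : c n = F n (fun m _ => c m) := by
      simp only [c]; exact Nat.strongRec_eq ..
    rw [this, Finset.sum_range]
  have hco : ∀ n : ℕ, Odd n → (n : ℤ) < 1 - 2 * b → c n = 0 := by
    intro n
    induction n using Nat.strong_induction_on with
    | _ n ih =>
      intro ho hn
      rw [hc, if_neg (by rintro rfl; simp at ho), Finset.sum_eq_zero, zero_div]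
      intro j hj
      rw [Finset.mem_range] at hj
      by_cases hjo : Odd j
      · rw [ih j (by omega) hjo (by omega), mul_zero]
      · rw [hodd _ _ (by omega), zero_mul]
        grind
  refine ⟨c, by simp [hc 0], fun n hn => ?_, fun n => ?_⟩
  · rw [hc n, if_neg hn, norm_div, norm_mul]
    have hn' : (n : ℝ) ≠ 0 := by exact_mod_cast hn
    by_cases hz : (n : ℤ) - 1 + 2 * b = 0
    · have hz' : (n : ℂ) - 1 + 2 * b = 0 := by exact_mod_cast hz
      simp [hz']
    · have h1 : (1 : ℝ) ≤ ‖(n : ℂ) - 1 + 2 * b‖ := by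
        have : ((n : ℂ) - 1 + 2 * b) = (((n : ℤ) - 1 + 2 * b : ℤ) : ℂ) := by push_cast; rfl
        rw [this, Complex.norm_intCast]
        exact_mod_cast Int.one_le_abs hz
      rw [Complex.norm_natCast, mul_div_assoc', mul_div_mul_left _ _ hn']
      exact div_le_self (norm_nonneg _) h1
  rcases Nat.eq_zero_or_pos n with rfl | hn
  · simp
  by_cases hz : (n : ℤ) - 1 + 2 * b = 0
  · have hz' : (n : ℂ) - 1 + 2 * b = 0 := by exact_mod_cast hz
    rw [hz', mul_zero, zero_mul, Finset.sum_eq_zero]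
    intro j hj
    rw [Finset.mem_range] at hj
    by_cases hjo : Odd j
    · rw [hco j hjo (by omega), mul_zero]
    · rw [hodd _ _ (by omega), zero_mul]
      grind
  · have hz' : (n : ℂ) - 1 + 2 * b ≠ 0 := by exact_mod_cast hz
    have hn' : (n : ℂ) ≠ 0 := by exact_mod_cast hn.ne'
    rw [hc n, if_neg hn.ne']
    field_simp


/-- The base dominates `A`, `M` and `1`, so each of the `n - 1` summands is at most `B ^ n`; their
number is absorbed by the factor `n` on the left of `hc`. -/
theorem norm_le_pow_of_frobenius {w c : ℕ → ℂ} {M A : ℝ} (hM : 0 ≤ M) (hA : 0 ≤ A)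
    (hw : ∀ n, ‖w n‖ ≤ M * A ^ n) (hc0 : c 0 = 1)
    (hc : ∀ n : ℕ, n ≠ 0 → n * ‖c n‖ ≤ ‖∑ j ∈ Finset.range (n - 1), w (n - 2 - j) * c j‖) (n : ℕ) :
    ‖c n‖ ≤ (A + M + 1) ^ n := by
  set B := A + M + 1 with hB
  have hB0 : 0 ≤ B := by positivity
  induction n using Nat.strong_induction_on with
  | _ n ih =>
    rcases Nat.eq_zero_or_pos n with rfl | hn
    · simp [hc0]
    have hsum : ‖∑ j ∈ Finset.range (n - 1), w (n - 2 - j) * c j‖ ≤ n * B ^ n := by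
      calc _ ≤ ∑ j ∈ Finset.range (n - 1), ‖w (n - 2 - j) * c j‖ := norm_sum_le _ _
        _ ≤ ∑ j ∈ Finset.range (n - 1), B ^ n := by
          refine Finset.sum_le_sum fun j hj => ?_
          rw [Finset.mem_range] at hj
          rw [norm_mul]
          calc ‖w (n - 2 - j)‖ * ‖c j‖ ≤ (M * A ^ (n - 2 - j)) * B ^ j :=
                mul_le_mul (hw _) (ih j (by omega)) (norm_nonneg _) (by positivity)
            _ ≤ (B * B ^ (n - 2 - j)) * B ^ j := by gcongr <;> linarith
            _ = B ^ (n - 1) := by rw [← pow_succ', ← pow_add]; congr 1; omega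
            _ ≤ B ^ n := pow_le_pow_right₀ (by linarith) (by omega)
        _ = (n - 1 : ℕ) * B ^ n := by simp
        _ ≤ n * B ^ n := by gcongr; omega
    have hn' : (0 : ℝ) < n := by exact_mod_cast hn
    exact le_of_mul_le_mul_left ((hc n hn.ne').trans hsum) hn'

open Filter Topology in
/-- The Frobenius method at exponent `b`: a solution `t ^ b * P` of `φ'' = (b (b - 1) / t ^ 2 + w) φ`
exists without logarithm if the odd Taylor coefficients of `w` of index below `-2 * b` vanish. -/
theorem exists_frobenius_solution (b : ℤ) {w : ℂ → ℂ} (hw : AnalyticAt ℂ w 0)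
    (hodd : ∀ i : ℕ, Odd i → (i : ℤ) < -2 * b → iteratedDeriv i w 0 = 0) :
    ∃ P : ℂ → ℂ, AnalyticAt ℂ P 0 ∧ P 0 = 1 ∧
      ∀ᶠ t in 𝓝 (0 : ℂ), t * deriv (deriv P) t + 2 * b * deriv P t = t * w t * P t := by
  set v : ℕ → ℂ := fun n => iteratedDeriv n w 0 / n.factorial with hv
  have hps := hw.hasFPowerSeriesAt
  have hwsum : ∀ᶠ t in 𝓝 (0 : ℂ), HasSum (fun k => t ^ k * v k) (w t) := by
    rw [hasFPowerSeriesAt_iff] at hps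
    filter_upwards [hps] with t ht
    simpa [hv] using ht
  obtain ⟨M, A, hM, hA, hbound⟩ : ∃ M A : ℝ, 0 ≤ M ∧ 0 ≤ A ∧ ∀ n, ‖v n‖ ≤ M * A ^ n := by
    have hr := hps.radius_pos
    obtain ⟨r, hr0, hr1⟩ := ENNReal.lt_iff_exists_nnreal_btwn.1 hr
    obtain ⟨M, hM, hb⟩ := FormalMultilinearSeries.norm_le_div_pow_of_pos_of_lt_radius _
      (by simpa using hr0) hr1
    refine ⟨M, (r : ℝ)⁻¹, hM.le, by positivity, fun n => ?_⟩
    have := hb n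
    rw [FormalMultilinearSeries.ofScalars_norm] at this
    simpa [hv, div_eq_mul_inv] using this
  obtain ⟨c, hc0, hcle, hcrec⟩ := exists_frobenius_coeff b v
    (fun i hi hlt => by simp [hv, hodd i hi hlt])
  have hcb := norm_le_pow_of_frobenius hM hA hbound hc0 hcle
  set B := A + M + 1
  have hB : 0 < B := by positivity
  set P : ℂ → ℂ := fun t => ∑' k, t ^ k * c k with hP
  have hPsum : ∀ᶠ t in 𝓝 (0 : ℂ), HasSum (fun k => t ^ k * c k) (P t) := by
    filter_upwards [Metric.ball_mem_nhds (0 : ℂ) (inv_pos.2 hB)] with t ht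
    refine Summable.hasSum ?_
    rw [mem_ball_zero_iff] at ht
    have h1 : ‖t‖ * B < 1 := by rwa [← lt_div_iff₀ hB, one_div]
    refine Summable.of_norm_bounded (summable_geometric_of_lt_one (by positivity) h1) fun k => ?_
    rw [norm_mul, norm_pow, mul_pow]
    gcongr
    exact hcb k
  obtain ⟨hPa, hP1⟩ := hasSum_deriv_of_eventually_hasSum hPsum
  obtain ⟨-, hP2⟩ := hasSum_deriv_of_eventually_hasSum hP1
  refine ⟨P, hPa, ?_, ?_⟩
  · rw [hP]
    simp only
    rw [tsum_eq_single 0 (fun k hk => by simp [hk])]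
    simp [hc0]
  filter_upwards [hwsum, hPsum, hP1, hP2] with t h0 h1 h2 h3
  have hprod := hasSum_sum_range_mul_of_summable_norm h1.summable.norm h0.summable.norm
  rw [h0.tsum_eq, h1.tsum_eq] at hprod
  have hl : HasSum (fun k => t ^ k * ((k + 1 : ℕ) * (k + 2 * b) * c (k + 1)))
      (t * deriv (deriv P) t + 2 * b * deriv P t) := by
    have h4 : HasSum (fun k => t ^ k * ((k * (k + 1) : ℕ) * c (k + 1))) (t * deriv (deriv P) t) := by
      rw [← hasSum_nat_add_iff' 1]
      simpa [pow_succ, mul_assoc, mul_comm, mul_left_comm, add_assoc, one_add_one_eq_two]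
        using h3.mul_left t
    convert h4.add (h2.mul_left (2 * b : ℂ)) using 2 with k
    push_cast
    ring
  have hr : HasSum (fun k => t ^ k * ((k + 1 : ℕ) * (k + 2 * b) * c (k + 1)))
      (t * w t * P t) := by
    -- The term `k = 0` is `2 b c₁`, zero by the recurrence at `n = 1`; the rest is the Cauchy
    -- product of `P` and `w` shifted by one.
    rw [← hasSum_nat_add_iff' 1]
    have hterm : ∀ k : ℕ, t ^ (k + 1) * ((k + 1 + 1 : ℕ) * ((k + 1 : ℕ) + 2 * b) * c (k + 1 + 1)) =
        t * ∑ j ∈ Finset.range (k + 1), t ^ j * c j * (t ^ (k - j) * v (k - j)) := by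
      intro k
      have h5 := hcrec (k + 2)
      rw [show k + 2 - 1 = k + 1 from rfl, show k + 2 - 2 = k from rfl] at h5
      push_cast at h5 ⊢
      have h6 : ∑ j ∈ Finset.range (k + 1), t ^ j * c j * (t ^ (k - j) * v (k - j)) =
          t ^ k * ∑ j ∈ Finset.range (k + 1), v (k - j) * c j := by
        rw [Finset.mul_sum]
        refine Finset.sum_congr rfl fun j hj => ?_
        rw [Finset.mem_range] at hj
        rw [show t ^ k = t ^ j * t ^ (k - j) by rw [← pow_add]; congr 1; omega]
        ring
      rw [h6, ← h5]
      ring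
    have hfirst : (2 * b : ℂ) * c 1 = 0 := by simpa using hcrec 1
    have h7 : t * w t * P t - ∑ i ∈ Finset.range 1,
        t ^ i * (((i + 1 : ℕ) : ℂ) * (i + 2 * b) * c (i + 1)) = t * (P t * w t) := by
      simp [hfirst]
      ring
    rw [h7]
    exact (hprod.mul_left t).congr_fun hterm
  exact hl.unique hr

/-! ### The two local forms and the passage between them. -/

open Filter Topology in
/-- Near `p` the function `f` is, up to a removable value at `p`, the sum of a simple polar part
with integer residue `n` and of an analytic function that is odd about `p` up to terms of order
`2 * |n|`. -/
def OddPolarAt (f : ℂ → ℂ) (p : ℂ) : Prop :=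
  ∃ (n : ℤ) (h e : ℂ → ℂ), AnalyticAt ℂ h 0 ∧ AnalyticAt ℂ e 0 ∧
    (∀ᶠ t in 𝓝[≠] (0 : ℂ), f (p + t) = n / t + h t) ∧
    ∀ᶠ t in 𝓝 (0 : ℂ), h t + h (-t) = t ^ (2 * n.natAbs) * e t

open Filter Topology in
/-- The local form of a potential `U` for which all solutions of `φ'' = (U + λ) φ` are
single-valued and meromorphic near `p`. -/
def TrivialMonodromyAt (U : ℂ → ℂ) (p : ℂ) : Prop :=
  ∃ (m : ℕ) (w s : ℂ → ℂ), AnalyticAt ℂ w 0 ∧ AnalyticAt ℂ s 0 ∧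
    (∀ᶠ t in 𝓝[≠] (0 : ℂ), U (p + t) = m * (m + 1) / t ^ 2 + w t) ∧
    ∀ᶠ t in 𝓝 (0 : ℂ), w t - w (-t) = t ^ (2 * m) * s t

open Filter Topology in
theorem eq_of_eventuallyEq_nhdsNE {f g : ℂ → ℂ} {x : ℂ} (hf : ContinuousAt f x)
    (hg : ContinuousAt g x) (h : ∀ᶠ t in 𝓝[≠] x, f t = g t) : f x = g x :=
  ((hf.eventuallyEq_nhds_iff_eventuallyEq_nhdsNE hg).1 h).self_of_nhds

open Filter Topology in
theorem eventually_nhdsNE_add_iff (p a : ℂ) {P : ℂ → Prop} :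
    (∀ᶠ z in 𝓝[≠] (p + a), P z) ↔ ∀ᶠ z in 𝓝[≠] p, P (z + a) := by
  rw [← map_add_right_nhdsNE]
  rfl

open Filter Topology in
theorem eventually_nhdsNE_iff_zero (p : ℂ) {P : ℂ → Prop} :
    (∀ᶠ z in 𝓝[≠] p, P z) ↔ ∀ᶠ t in 𝓝[≠] (0 : ℂ), P (p + t) := by
  simpa [add_comm] using eventually_nhdsNE_add_iff 0 p (P := P)

open Filter Topology in
theorem eventually_neg_nhds_zero {P : ℂ → Prop} (h : ∀ᶠ t in 𝓝 (0 : ℂ), P t) :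
    ∀ᶠ t in 𝓝 (0 : ℂ), P (-t) :=
  (continuous_neg.tendsto' (0 : ℂ) 0 neg_zero).eventually h

theorem AnalyticAt.comp_neg_zero {h : ℂ → ℂ} (hh : AnalyticAt ℂ h 0) :
    AnalyticAt ℂ (fun t => h (-t)) 0 :=
  AnalyticAt.fun_comp (by simpa using hh) analyticAt_id.neg

theorem AnalyticAt.dslope_self {h : ℂ → ℂ} {x : ℂ} (hh : AnalyticAt ℂ h x) :
    AnalyticAt ℂ (dslope h x) x := by
  obtain ⟨p, hp⟩ := hh
  exact ⟨_, hp.has_fpower_series_dslope_fslope⟩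

theorem eq_add_mul_dslope_zero (h : ℂ → ℂ) (t : ℂ) : h t = h 0 + t * dslope h 0 t := by
  have := sub_smul_dslope h 0 t
  simp only [sub_zero, smul_eq_mul] at this
  rw [this]; ring

open Filter Topology in
theorem eventually_deriv_add_neg {h : ℂ → ℂ} (hh : AnalyticAt ℂ h 0) :
    ∀ᶠ t in 𝓝 (0 : ℂ), deriv (fun t => h t + h (-t)) t = deriv h t - deriv h (-t) := by
  filter_upwards [hh.eventually_analyticAt, eventually_neg_nhds_zero hh.eventually_analyticAt]
    with t h1 h2
  have h3 : HasDerivAt (fun t => h (-t)) (-deriv h (-t)) t := by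
    simpa [Function.comp_def] using
      HasDerivAt.comp t h2.differentiableAt.hasDerivAt (hasDerivAt_neg t)
  rw [(h1.differentiableAt.hasDerivAt.fun_add h3).deriv]
  ring

open Filter Topology in
theorem eventually_deriv_pow_mul {c : ℂ → ℂ} (hc : AnalyticAt ℂ c 0) (N : ℕ) :
    ∀ᶠ t in 𝓝 (0 : ℂ), t * deriv (fun t => t ^ N * c t) t = t ^ N * (N * c t + t * deriv c t) := by
  filter_upwards [hc.eventually_analyticAt] with t h1
  rw [((hasDerivAt_pow N t).fun_mul h1.differentiableAt.hasDerivAt).deriv]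
  rcases N with _ | N
  · simp
  · simp [pow_succ]; ring

open Filter Topology in
theorem eventually_deriv_of_eq_div_add {f h : ℂ → ℂ} {p c : ℂ} (hh : AnalyticAt ℂ h 0)
    (hf : ∀ᶠ t in 𝓝[≠] (0 : ℂ), f (p + t) = c / t + h t) :
    ∀ᶠ t in 𝓝[≠] (0 : ℂ), deriv f (p + t) = -c / t ^ 2 + deriv h t := by
  have h1 : (fun t => f (p + t)) =ᶠ[𝓝[≠] 0] fun t => c / t + h t := hf
  filter_upwards [h1.nhdsNE_deriv, self_mem_nhdsWithin,
    hh.eventually_analyticAt.filter_mono nhdsWithin_le_nhds] with t ht ht0 hta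
  rw [deriv_comp_const_add] at ht
  rw [ht]
  have h2 : HasDerivAt (fun t => c / t) (-c / t ^ 2) t := by
    simpa using (hasDerivAt_const t c).fun_div (hasDerivAt_id' t) ht0
  exact (h2.fun_add hta.differentiableAt.hasDerivAt).deriv

-- The double pole has coefficient `n(n - 1) = m(m + 1)` with `m = -n` or `m = n - 1`. In the odd
-- part of `t w`, the terms `2|n| e` and `2n e` cancel if `n < 0`, which gains the factor `t` to be
-- divided out; if `n > 0`, the exponent `2|n| = 2m + 2` already suffices.
open Filter Topology in
theorem OddPolarAt.trivialMonodromyAt {f : ℂ → ℂ} {p : ℂ} (hf : OddPolarAt f p) (μ : ℂ) :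
    TrivialMonodromyAt (fun z => deriv f z + f z ^ 2 - μ) p := by
  obtain ⟨n, h, e, hh, he, hfh, hhe⟩ := hf
  -- This removes the `1/t` term of `f²`.
  have hn0 : (n : ℂ) * h 0 = 0 := by
    rcases eq_or_ne n 0 with rfl | hn
    · simp
    · have := hhe.self_of_nhds
      rw [zero_pow (by simpa using hn)] at this
      have : h 0 = 0 := by simpa using this
      simp [this]
  set w : ℂ → ℂ := fun t => deriv h t + 2 * n * dslope h 0 t + h t ^ 2 - μ with hw
  have hwa : AnalyticAt ℂ w 0 :=
    ((hh.deriv.add (analyticAt_const.mul hh.dslope_self)).add (hh.pow 2)).sub analyticAt_const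
  have hU : ∀ m : ℕ, (m : ℂ) * (m + 1) = n * (n - 1) → ∀ᶠ t in 𝓝[≠] (0 : ℂ),
      deriv f (p + t) + f (p + t) ^ 2 - μ = m * (m + 1) / t ^ 2 + w t := by
    intro m hm
    filter_upwards [hfh, eventually_deriv_of_eq_div_add hh hfh, self_mem_nhdsWithin]
      with t h1 h2 (h3 : t ≠ 0)
    rw [h1, h2, hm, hw]
    have h4 := eq_add_mul_dslope_zero h t
    have h5 : (n : ℂ) * h t = t * (n * dslope h 0 t) := by
      rw [h4]; linear_combination hn0
    field_simp
    linear_combination 2 * t * h5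
  have hwodd : ∀ᶠ t in 𝓝 (0 : ℂ), t * (w t - w (-t)) = t ^ (2 * n.natAbs) *
      ((2 * n.natAbs * e t + t * deriv e t) + e t * (2 * n + t * (h t - h (-t)))) := by
    have hE : (fun t => h t + h (-t)) =ᶠ[𝓝 0] fun t => t ^ (2 * n.natAbs) * e t := hhe
    filter_upwards [hhe, eventually_deriv_add_neg hh, hE.deriv,
      eventually_deriv_pow_mul he (2 * n.natAbs)] with t h1 h2 h3 h4
    have h6 := eq_add_mul_dslope_zero h t
    have h7 := eq_add_mul_dslope_zero h (-t)
    rw [h2] at h3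
    rw [← h3] at h4
    push_cast at h4
    simp only [hw]
    linear_combination h4 + (2 * n + t * (h t - h (-t))) * h1 - 2 * n * (h6 + h7) - 4 * hn0
  rcases lt_trichotomy n 0 with hn | rfl | hn
  · obtain ⟨m, rfl⟩ : ∃ m : ℕ, n = -m := ⟨n.natAbs, by omega⟩
    have hsa : AnalyticAt ℂ (fun t => deriv e t + e t * (h t - h (-t))) 0 :=
      he.deriv.add (he.mul (hh.sub hh.comp_neg_zero))
    refine ⟨m, w, _, hwa, hsa, hU m (by push_cast; ring), ?_⟩
    refine (ContinuousAt.eventuallyEq_nhds_iff_eventuallyEq_nhdsNE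
      (hwa.sub hwa.comp_neg_zero).continuousAt
      ((analyticAt_id.pow (2 * m)).mul hsa).continuousAt).1 ?_
    filter_upwards [hwodd.filter_mono nhdsWithin_le_nhds, self_mem_nhdsWithin]
      with t h1 (h2 : t ≠ 0)
    refine mul_left_cancel₀ h2 ?_
    simp only [Int.natAbs_neg, Int.natAbs_natCast, Int.cast_neg, Int.cast_natCast] at h1
    simp only [Pi.sub_apply, Pi.mul_apply, Pi.pow_apply, id_eq]
    linear_combination h1
  · exact ⟨0, w, fun t => w t - w (-t), hwa, hwa.sub hwa.comp_neg_zero, hU 0 (by simp), by simp⟩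
  · obtain ⟨m, rfl⟩ : ∃ m : ℕ, n = (m + 1 : ℕ) := ⟨n.natAbs - 1, by omega⟩
    have hsa : AnalyticAt ℂ (fun t => t * ((2 * (m + 1) * e t + t * deriv e t) +
        e t * (2 * (m + 1) + t * (h t - h (-t))))) 0 :=
      analyticAt_id.mul (((analyticAt_const.mul he).add (analyticAt_id.mul he.deriv)).add
        (he.mul (analyticAt_const.add (analyticAt_id.mul (hh.sub hh.comp_neg_zero)))))
    refine ⟨m, w, _, hwa, hsa, hU m (by push_cast; ring), ?_⟩
    refine (ContinuousAt.eventuallyEq_nhds_iff_eventuallyEq_nhdsNE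
      (hwa.sub hwa.comp_neg_zero).continuousAt
      ((analyticAt_id.pow (2 * m)).mul hsa).continuousAt).1 ?_
    filter_upwards [hwodd.filter_mono nhdsWithin_le_nhds, self_mem_nhdsWithin]
      with t h1 (h2 : t ≠ 0)
    refine mul_left_cancel₀ h2 ?_
    simp only [Int.natAbs_natCast, Int.cast_natCast] at h1
    push_cast at h1
    simp only [Pi.sub_apply, Pi.mul_apply, Pi.pow_apply, id_eq]
    rw [h1]
    ring

open Filter Topology in
/-- A meromorphic solution `g` of `g ^ 2 - g' = w` with a potential `w` having at most a double
pole has at most a simple pole. -/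
theorem exists_eq_div_of_riccati {g U w : ℂ → ℂ} {p κ : ℂ} (hg : MeromorphicAt g p)
    (hw : AnalyticAt ℂ w 0) (hU : ∀ᶠ t in 𝓝[≠] (0 : ℂ), U (p + t) = κ / t ^ 2 + w t)
    (hgU : ∀ᶠ t in 𝓝[≠] (0 : ℂ), g (p + t) ^ 2 - deriv g (p + t) = U (p + t)) :
    ∃ C : ℂ → ℂ, AnalyticAt ℂ C 0 ∧ ∀ᶠ t in 𝓝[≠] (0 : ℂ), g (p + t) = C t / t := by
  have hG : MeromorphicAt (fun t => g (p + t)) 0 :=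
    MeromorphicAt.comp_analyticAt (f := g) (g := fun t => p + t) (by simpa using hg) (by fun_prop)
  by_cases htop : meromorphicOrderAt (fun t => g (p + t)) 0 = ⊤
  · refine ⟨0, analyticAt_const, ?_⟩
    filter_upwards [meromorphicOrderAt_eq_top_iff.1 htop] with t ht
    simp [ht]
  obtain ⟨c, hc, hc0, hGc⟩ := (meromorphicOrderAt_ne_top_iff hG).1 htop
  set N := (meromorphicOrderAt (fun t => g (p + t)) 0).untop₀
  simp only [sub_zero, smul_eq_mul] at hGc
  rcases le_or_gt (-1) N with hN | hN
  · obtain ⟨k, hk⟩ : ∃ k : ℕ, N = k - 1 := ⟨(N + 1).toNat, by omega⟩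
    refine ⟨fun t => t ^ k * c t, by fun_prop, ?_⟩
    filter_upwards [hGc, self_mem_nhdsWithin] with t h1 (h2 : t ≠ 0)
    rw [h1, hk, zpow_sub₀ h2]
    simp
    ring
  -- A pole of order `k + 2` of `g` gives `g²` order `2k + 4`, more than `g'` or `U` can compensate.
  · exfalso
    obtain ⟨k, hk⟩ : ∃ k : ℕ, N = -(k + 2 : ℕ) := ⟨(-N - 2).toNat, by omega⟩
    have hG2 : (fun t => g (p + t)) =ᶠ[𝓝[≠] 0] fun t => c t / t ^ (k + 2) := by
      filter_upwards [hGc] with t h1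
      rw [h1, hk, zpow_neg, zpow_natCast]
      ring
    refine hc0 (pow_eq_zero_iff two_ne_zero |>.1 ?_)
    have hl : AnalyticAt ℂ (fun t => c t ^ 2) 0 := hc.pow 2
    have hr : AnalyticAt ℂ (fun t => t * (t ^ (k + 1) * deriv c t - (k + 2) * t ^ k * c t +
        t ^ (2 * k + 1) * (κ + t ^ 2 * w t))) 0 := by
      have := hc.deriv
      fun_prop
    refine (eq_of_eventuallyEq_nhdsNE hl.continuousAt hr.continuousAt ?_).trans (by simp)
    filter_upwards [hG2, hG2.nhdsNE_deriv, hU, hgU, self_mem_nhdsWithin,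
      hc.eventually_analyticAt.filter_mono nhdsWithin_le_nhds] with t h1 h2 h3 h4 (h5 : t ≠ 0) h6
    rw [deriv_comp_const_add, (h6.differentiableAt.hasDerivAt.fun_div (hasDerivAt_pow (k + 2) t)
      (pow_ne_zero _ h5)).deriv] at h2
    rw [h3, h1, h2] at h4
    simp only [show k + 2 - 1 = k + 1 from rfl] at h4
    push_cast at h4
    have e1 : t ^ (k + 2) = t ^ k * t ^ 2 := pow_add ..
    have e2 : t ^ (k + 1) = t ^ k * t := pow_succ ..
    have e3 : t ^ (2 * k + 1) = t ^ k * t ^ k * t := by ring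
    have h7 : t ^ k ≠ 0 := pow_ne_zero _ h5
    rw [e1, e2] at h4
    rw [e2, e3]
    generalize t ^ k = T at *
    field_simp at h4
    linear_combination h4

open Filter Topology in
/-- Meromorphic solutions of the Riccati equation `g ^ 2 - g' = U` with a potential of trivial
monodromy have the form of `OddPolarAt`. -/
theorem TrivialMonodromyAt.oddPolarAt_of_riccati {g U : ℂ → ℂ} {p : ℂ}
    (hU : TrivialMonodromyAt U p) (hg : MeromorphicAt g p)
    (hgU : ∀ᶠ z in 𝓝[≠] p, g z ^ 2 - deriv g z = U z) : OddPolarAt g p := by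
  obtain ⟨m, w, s, hw, hs, hUw, hws⟩ := hU
  have hgU' : ∀ᶠ t in 𝓝[≠] (0 : ℂ), g (p + t) ^ 2 - deriv g (p + t) = U (p + t) :=
    (eventually_nhdsNE_iff_zero p).1 hgU
  obtain ⟨C, hC, hgC⟩ := exists_eq_div_of_riccati hg hw hUw hgU'
  set h := dslope C 0 with hh_def
  have hh : AnalyticAt ℂ h 0 := hC.dslope_self
  have hgh : ∀ᶠ t in 𝓝[≠] (0 : ℂ), g (p + t) = C 0 / t + h t := by
    filter_upwards [hgC, self_mem_nhdsWithin] with t h1 (h2 : t ≠ 0)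
    rw [h1, eq_add_mul_dslope_zero C t]
    field_simp
    rfl
  have hric : ∀ᶠ t in 𝓝[≠] (0 : ℂ), C 0 ^ 2 + C 0 + 2 * C 0 * h t * t + t ^ 2 * (h t ^ 2 - deriv h t) =
      m * (m + 1) + t ^ 2 * w t := by
    filter_upwards [hgh, eventually_deriv_of_eq_div_add hh hgh, hUw, hgU', self_mem_nhdsWithin]
      with t h1 h2 h3 h4 (h5 : t ≠ 0)
    rw [h3, h1, h2] at h4
    field_simp at h4
    linear_combination h4
  have hind : C 0 ^ 2 + C 0 = m * (m + 1) := by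
    have hl : AnalyticAt ℂ (fun t => C 0 ^ 2 + C 0 + 2 * C 0 * h t * t +
        t ^ 2 * (h t ^ 2 - deriv h t)) 0 := by
      have := hh.deriv
      fun_prop
    have hr : AnalyticAt ℂ (fun t => (m : ℂ) * (m + 1) + t ^ 2 * w t) 0 := by fun_prop
    simpa using eq_of_eventuallyEq_nhdsNE hl.continuousAt hr.continuousAt hric
  -- The indicial equation forces the residue to be an integer.
  obtain ⟨b, hb, hbm⟩ : ∃ b : ℤ, C 0 = b ∧ (b = m ∨ b = -(m + 1 : ℕ)) := by
    have : (C 0 - m) * (C 0 + (m + 1)) = 0 := by linear_combination hind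
    rcases mul_eq_zero.1 this with h1 | h1
    · exact ⟨m, by simpa using sub_eq_zero.1 h1, Or.inl rfl⟩
    · exact ⟨-(m + 1 : ℕ), by simpa using eq_neg_of_add_eq_zero_left h1, Or.inr rfl⟩
  have hlin : ∀ᶠ t in 𝓝 (0 : ℂ), 2 * b * h t + t * (h t ^ 2 - deriv h t) = t * w t := by
    have hl : AnalyticAt ℂ (fun t => 2 * b * h t + t * (h t ^ 2 - deriv h t)) 0 := by
      have := hh.deriv
      fun_prop
    have hr : AnalyticAt ℂ (fun t => t * w t) 0 := by fun_prop
    refine (ContinuousAt.eventuallyEq_nhds_iff_eventuallyEq_nhdsNE hl.continuousAt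
      hr.continuousAt).1 ?_
    filter_upwards [hric, self_mem_nhdsWithin] with t h1 (h2 : t ≠ 0)
    refine mul_left_cancel₀ h2 ?_
    rw [hind, hb] at h1
    linear_combination h1
  rw [hb] at hgh
  have hEa : AnalyticAt ℂ (fun t => h t + h (-t)) 0 := hh.add hh.comp_neg_zero
  rcases hEa.eventually_eq_zero_or_eventually_ne_zero with hE | hE
  · exact ⟨b, h, 0, hh, analyticAt_const, hgh, by simpa using hE⟩
  have hEtop : analyticOrderAt (fun t => h t + h (-t)) 0 ≠ ⊤ := by
    rw [Ne, analyticOrderAt_eq_top]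
    intro h0
    obtain ⟨t, h1, h2⟩ := ((h0.filter_mono nhdsWithin_le_nhds).and hE).exists
    exact h2 h1
  obtain ⟨c, hc, hc0, hEc⟩ := (hEa.analyticOrderAt_ne_top).1 hEtop
  set N := analyticOrderNatAt (fun t => h t + h (-t)) 0
  simp only [sub_zero, smul_eq_mul] at hEc
  rcases le_or_gt (2 * b.natAbs) N with hN | hN
  · refine ⟨b, h, fun t => t ^ (N - 2 * b.natAbs) * c t, hh, by fun_prop, hgh, ?_⟩
    filter_upwards [hEc] with t ht
    rw [ht, ← mul_assoc, ← pow_add]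
    congr 2
    omega
  exfalso
  -- `h t + h (-t)` is even, so its order of vanishing is even. This turns `N < 2m + 2` into `N ≤
  -- 2m` when `b = -(m + 1)`.
  have hNeven : Even N := by
    by_contra hodd
    rw [Nat.not_even_iff_odd] at hodd
    refine hc0 (self_eq_neg.1 ?_)
    have h0 : c (0 : ℂ) = (fun t => -c (-t)) 0 :=
      eq_of_eventuallyEq_nhdsNE hc.continuousAt hc.comp_neg_zero.neg.continuousAt (by
        filter_upwards [hEc.filter_mono nhdsWithin_le_nhds,
          (eventually_neg_nhds_zero hEc).filter_mono nhdsWithin_le_nhds, self_mem_nhdsWithin]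
          with t h1 h2 (h3 : t ≠ 0)
        rw [hodd.neg_pow, neg_neg] at h2
        refine mul_left_cancel₀ (pow_ne_zero N h3) ?_
        change t ^ N * c t = t ^ N * -c (-t)
        linear_combination h2 - h1)
    simpa using h0
  have hN2 : N ≤ 2 * m := by
    obtain ⟨j, hj⟩ := hNeven
    omega
  -- With `E = h(t) + h(-t)`, adding `hlin` at `t` and `-t` gives `2bE + tE(h(t) - h(-t)) - tE' =
  -- t^(2m+1) s`. As `N ≤ 2m`, the coefficient of `t^N` on the left must vanish, which contradicts
  -- `N < 2|b|`.
  have hkey : (2 * b - N : ℂ) * c 0 = 0 := by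
    have hl : AnalyticAt ℂ (fun t => 2 * b * c t + t * c t * (h t - h (-t)) - N * c t -
        t * deriv c t) 0 :=
      (((analyticAt_const.mul hc).add ((analyticAt_id.mul hc).mul (hh.sub hh.comp_neg_zero))).sub
        (analyticAt_const.mul hc)).sub (analyticAt_id.mul hc.deriv)
    have hr : AnalyticAt ℂ (fun t => t ^ (2 * m - N + 1) * s t) 0 := by fun_prop
    have h0 := eq_of_eventuallyEq_nhdsNE hl.continuousAt hr.continuousAt (by
      have hE' : (fun t => h t + h (-t)) =ᶠ[𝓝 0] fun t => t ^ N * c t := hEc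
      filter_upwards [hEc.filter_mono nhdsWithin_le_nhds, hws.filter_mono nhdsWithin_le_nhds,
        hlin.filter_mono nhdsWithin_le_nhds,
        (eventually_neg_nhds_zero hlin).filter_mono nhdsWithin_le_nhds,
        hE'.deriv.filter_mono nhdsWithin_le_nhds,
        (eventually_deriv_add_neg hh).filter_mono nhdsWithin_le_nhds,
        (eventually_deriv_pow_mul hc N).filter_mono nhdsWithin_le_nhds, self_mem_nhdsWithin]
        with t h1 h2 h3 h4 h5 h6 h7 (h8 : t ≠ 0)
      rw [h6] at h5
      rw [← h5] at h7
      refine mul_left_cancel₀ (pow_ne_zero N h8) ?_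
      have h9 : t ^ N * (t ^ (2 * m - N + 1) * s t) = t * (t ^ (2 * m) * s t) := by
        rw [← mul_assoc, ← pow_add, ← mul_assoc, ← pow_succ']
        congr 2
        omega
      rw [h9, ← h2]
      linear_combination h3 + h4 + h7 - (2 * b + t * (h t - h (-t))) * h1)
    simp at h0
    linear_combination h0
  rcases mul_eq_zero.1 hkey with h1 | h1
  · have : 2 * b - N = 0 := by exact_mod_cast h1
    omega
  · exact hc0 h1

/-! ### Order of the pole and stability of the local form. -/

open Filter Topology in
theorem OddPolarAt.exists_eq_inv_mul {f : ℂ → ℂ} {p : ℂ} (hf : OddPolarAt f p) :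
    ∃ A : ℂ → ℂ, AnalyticAt ℂ A p ∧ f =ᶠ[𝓝[≠] p] fun z => (z - p) ^ (-1 : ℤ) * A z := by
  obtain ⟨n, h, e, hh, -, hfh, -⟩ := hf
  refine ⟨fun z => n + (z - p) * h (z - p), ?_, ?_⟩
  · have : AnalyticAt ℂ (fun z => h (z - p)) p :=
      AnalyticAt.fun_comp (f := fun z => z - p) (by simpa using hh) (by fun_prop)
    exact analyticAt_const.add ((analyticAt_id.sub analyticAt_const).mul this)
  · refine (eventually_nhdsNE_iff_zero p).2 ?_
    filter_upwards [hfh, self_mem_nhdsWithin] with t h1 (h2 : t ≠ 0)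
    rw [h1, add_sub_cancel_left, zpow_neg_one]
    field_simp

theorem meromorphicAt_sub_zpow_neg_one (p : ℂ) :
    MeromorphicAt (fun z => (z - p) ^ (-1 : ℤ)) p :=
  MeromorphicAt.fun_zpow (f := fun z => z - p) (AnalyticAt.meromorphicAt (by fun_prop)) _

theorem OddPolarAt.meromorphicAt {f : ℂ → ℂ} {p : ℂ} (hf : OddPolarAt f p) :
    MeromorphicAt f p := by
  obtain ⟨A, hA, hfA⟩ := hf.exists_eq_inv_mul
  exact ((meromorphicAt_sub_zpow_neg_one p).fun_mul hA.meromorphicAt).congr hfA.symm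

theorem OddPolarAt.neg_one_le_meromorphicOrderAt {f : ℂ → ℂ} {p : ℂ} (hf : OddPolarAt f p) :
    ((-1 : ℤ) : WithTop ℤ) ≤ meromorphicOrderAt f p := by
  obtain ⟨A, hA, hfA⟩ := hf.exists_eq_inv_mul
  have h1 : meromorphicOrderAt (fun z => (z - p) ^ (-1 : ℤ)) p = ((-1 : ℤ) : WithTop ℤ) := by
    rw [meromorphicOrderAt_eq_int_iff (meromorphicAt_sub_zpow_neg_one p)]
    exact ⟨fun _ => 1, analyticAt_const, one_ne_zero, by simp⟩
  rw [meromorphicOrderAt_congr hfA]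
  have h2 := meromorphicOrderAt_mul (meromorphicAt_sub_zpow_neg_one p) hA.meromorphicAt
  rw [h1] at h2
  exact (le_add_of_nonneg_right hA.meromorphicOrderAt_nonneg).trans h2.ge

theorem AnalyticAt.oddPolarAt {f : ℂ → ℂ} {p : ℂ} (hf : AnalyticAt ℂ f p) : OddPolarAt f p := by
  have h : AnalyticAt ℂ (fun t => f (p + t)) 0 :=
    AnalyticAt.fun_comp (f := fun t => p + t) (by simpa using hf) (by fun_prop)
  exact ⟨0, fun t => f (p + t), fun t => f (p + t) + f (p + -t), h,
    h.add h.comp_neg_zero, by simp, by simp⟩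

open Filter Topology in
theorem OddPolarAt.congr {f g : ℂ → ℂ} {p : ℂ} (hf : OddPolarAt f p) (h : f =ᶠ[𝓝[≠] p] g) :
    OddPolarAt g p := by
  obtain ⟨n, k, e, hk, he, hfk, hke⟩ := hf
  refine ⟨n, k, e, hk, he, ?_, hke⟩
  filter_upwards [hfk, (eventually_nhdsNE_iff_zero p).1 h] with t h1 h2
  rw [← h1, h2]

theorem OddPolarAt.comp_add_const {f : ℂ → ℂ} {p a : ℂ} (hf : OddPolarAt f (p + a)) :
    OddPolarAt (fun z => f (z + a)) p := by
  obtain ⟨n, k, e, hk, he, hfk, hke⟩ := hf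
  exact ⟨n, k, e, hk, he, by simpa [add_right_comm] using hfk, hke⟩

/-! ### The Riccati equation: uniqueness and linearization. -/

-- The difference `d` of two solutions satisfies `d' = (g₁ + g₂) d`. If `d` vanished at `q` without
-- vanishing identically, its logarithmic derivative would have a pole there, while `g₁ + g₂` is
-- analytic.
open Filter Topology in
theorem AnalyticAt.eventuallyEq_of_riccati {g₁ g₂ U : ℂ → ℂ} {q : ℂ} (h₁ : AnalyticAt ℂ g₁ q)
    (h₂ : AnalyticAt ℂ g₂ q) (hU₁ : ∀ᶠ z in 𝓝[≠] q, g₁ z ^ 2 - deriv g₁ z = U z)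
    (hU₂ : ∀ᶠ z in 𝓝[≠] q, g₂ z ^ 2 - deriv g₂ z = U z) (hq : g₁ q = g₂ q) :
    g₁ =ᶠ[𝓝 q] g₂ := by
  have hd : AnalyticAt ℂ (g₁ - g₂) q := h₁.sub h₂
  rcases hd.eventually_eq_zero_or_eventually_ne_zero with h0 | hne
  · filter_upwards [h0] with z hz using sub_eq_zero.1 hz
  exfalso
  have hpos : 0 < meromorphicOrderAt (g₁ - g₂) q := by
    rw [← tendsto_zero_iff_meromorphicOrderAt_pos hd.meromorphicAt]
    have := hd.continuousAt.tendsto.mono_left (nhdsWithin_le_nhds (s := {q}ᶜ))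
    simpa [hq] using this
  have htop : meromorphicOrderAt (g₁ - g₂) q ≠ ⊤ :=
    (meromorphicOrderAt_ne_top_iff_eventually_ne_zero hd.meromorphicAt).2 hne
  have hlog := meromorphicOrderAt_logDeriv_eq_neg_one hd.meromorphicAt hpos.ne' htop
  have heq : logDeriv (g₁ - g₂) =ᶠ[𝓝[≠] q] g₁ + g₂ := by
    filter_upwards [hU₁, hU₂, hne, h₁.eventually_analyticAt.filter_mono nhdsWithin_le_nhds,
      h₂.eventually_analyticAt.filter_mono nhdsWithin_le_nhds] with z e1 e2 e3 a1 a2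
    rw [logDeriv_apply, deriv_sub a1.differentiableAt a2.differentiableAt, div_eq_iff e3]
    simp only [Pi.add_apply, Pi.sub_apply]
    linear_combination e2 - e1
  rw [meromorphicOrderAt_congr heq] at hlog
  have := (h₁.add h₂).meromorphicOrderAt_nonneg
  rw [hlog] at this
  exact absurd this (by decide)

open Filter Topology in
theorem eventually_zpow_mul_deriv {P : ℂ → ℂ} (hP : AnalyticAt ℂ P 0) (b : ℤ) :
    ∀ᶠ t in 𝓝[≠] (0 : ℂ), AnalyticAt ℂ (fun t => t ^ b * P t) t ∧
      deriv (fun t => t ^ b * P t) t = t ^ b * (b * t⁻¹ * P t + deriv P t) ∧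
      deriv (deriv fun t => t ^ b * P t) t =
        t ^ b * (b * (b - 1) / t ^ 2 * P t + 2 * b * t⁻¹ * deriv P t + deriv (deriv P) t) := by
  have hz : ∀ t : ℂ, t ≠ 0 → HasDerivAt (fun t : ℂ => t ^ b) (t ^ b * (b * t⁻¹)) t := by
    intro t ht
    have := hasDerivAt_zpow b t (Or.inl ht)
    rw [zpow_sub_one₀ ht] at this
    exact this.congr_deriv (by ring)
  have h1 : deriv (fun t => t ^ b * P t) =ᶠ[𝓝[≠] 0]
      fun t => t ^ b * (b * t⁻¹ * P t + deriv P t) := by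
    filter_upwards [hP.eventually_analyticAt.filter_mono nhdsWithin_le_nhds, self_mem_nhdsWithin]
      with t ha (ht : t ≠ 0)
    rw [((hz t ht).fun_mul ha.differentiableAt.hasDerivAt).deriv]
    ring
  filter_upwards [h1, h1.nhdsNE_deriv, self_mem_nhdsWithin,
    hP.eventually_analyticAt.filter_mono nhdsWithin_le_nhds] with t e1 e2 (ht : t ≠ 0) ha
  refine ⟨(analyticAt_id.fun_zpow ht).mul ha, e1, ?_⟩
  rw [e2, ((hz t ht).fun_mul ((((hasDerivAt_inv ht).const_mul (b : ℂ)).fun_mul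
    ha.differentiableAt.hasDerivAt).fun_add ha.deriv.differentiableAt.hasDerivAt)).deriv]
  field_simp
  ring

-- The exponents are `-m` and `m + 1`. The vanishing odd coefficients serve the first; for the
-- second the resonance condition is void.
open Filter Topology in
theorem TrivialMonodromyAt.exists_fundamental_system {U : ℂ → ℂ} {p : ℂ}
    (hU : TrivialMonodromyAt U p) :
    ∃ φ₁ φ₂ : ℂ → ℂ, MeromorphicAt φ₁ p ∧ MeromorphicAt φ₂ p ∧
      ∀ᶠ z in 𝓝[≠] p, AnalyticAt ℂ φ₁ z ∧ AnalyticAt ℂ φ₂ z ∧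
        deriv (deriv φ₁) z = U z * φ₁ z ∧ deriv (deriv φ₂) z = U z * φ₂ z ∧
        φ₁ z * deriv φ₂ z - deriv φ₁ z * φ₂ z ≠ 0 := by
  obtain ⟨m, w, s, hw, hs, hUw, hws⟩ := hU
  have hodd : ∀ i : ℕ, Odd i → i < 2 * m → iteratedDeriv i w 0 = 0 := by
    intro i hi him
    have hd : AnalyticAt ℂ (fun t => w t - w (-t)) 0 := hw.sub hw.comp_neg_zero
    have hord : ((2 * m : ℕ) : ℕ∞) ≤ analyticOrderAt (fun t => w t - w (-t)) 0 := by
      rw [natCast_le_analyticOrderAt hd]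
      exact ⟨s, hs, by simpa using hws⟩
    rw [natCast_le_analyticOrderAt_iff_iteratedDeriv_eq_zero hd] at hord
    have h1 := hord i him
    have h2 := iteratedDeriv_comp_neg i w 0
    rw [iteratedDeriv_fun_sub hw.contDiffAt hw.comp_neg_zero.contDiffAt, h2, hi.neg_one_pow] at h1
    simpa using h1
  obtain ⟨P₁, hP₁, h10, hP₁e⟩ := exists_frobenius_solution (-m) hw
    (fun i hi hlt => hodd i hi (by omega))
  obtain ⟨P₂, hP₂, h20, hP₂e⟩ := exists_frobenius_solution (m + 1) hw
    (fun i hi hlt => by omega)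
  have hmero : ∀ (b : ℤ) (P : ℂ → ℂ), AnalyticAt ℂ P 0 →
      MeromorphicAt (fun z => (z - p) ^ b * P (z - p)) p := by
    intro b P hP
    have : AnalyticAt ℂ (fun z => P (z - p)) p :=
      AnalyticAt.fun_comp (f := fun z => z - p) (by simpa using hP) (by fun_prop)
    exact (MeromorphicAt.fun_zpow (f := fun z => z - p) (AnalyticAt.meromorphicAt (by fun_prop))
      _).fun_mul this.meromorphicAt
  refine ⟨_, _, hmero (-m) P₁ hP₁, hmero (m + 1) P₂ hP₂, (eventually_nhdsNE_iff_zero p).2 ?_⟩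
  -- This is the Wronskian with the powers of `t` cancelled; its value at `0` is `2m + 1`.
  have hW : ∀ᶠ t in 𝓝 (0 : ℂ), P₁ t * ((m + 1) * P₂ t + t * deriv P₂ t) -
      (-m * P₁ t + t * deriv P₁ t) * P₂ t ≠ 0 := by
    have hc : ContinuousAt (fun t => P₁ t * ((m + 1) * P₂ t + t * deriv P₂ t) -
      (-m * P₁ t + t * deriv P₁ t) * P₂ t) 0 := by
      have := hP₁.continuousAt
      have := hP₂.continuousAt
      have := hP₁.deriv.continuousAt
      have := hP₂.deriv.continuousAt
      fun_prop
    refine hc.eventually_ne ?_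
    have : (m : ℂ) + 1 + m ≠ 0 := by exact_mod_cast (by omega : m + 1 + m ≠ 0)
    simpa [h10, h20] using this
  filter_upwards [eventually_zpow_mul_deriv hP₁ (-m), eventually_zpow_mul_deriv hP₂ (m + 1),
    hW.filter_mono nhdsWithin_le_nhds, hUw, hP₁e.filter_mono nhdsWithin_le_nhds,
    hP₂e.filter_mono nhdsWithin_le_nhds, self_mem_nhdsWithin]
    with t ⟨a1, d1, dd1⟩ ⟨a2, d2, dd2⟩ hW hU e1 e2 (ht : t ≠ 0)
  have hshift : ∀ (b : ℤ) (P : ℂ → ℂ) (u : ℂ), deriv (fun z => (z - p) ^ b * P (z - p)) u =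
      deriv (fun t => t ^ b * P t) (u - p) := fun b P u =>
    deriv_comp_sub_const (f := fun t => t ^ b * P t) p u
  have hshift2 : ∀ (b : ℤ) (P : ℂ → ℂ) (u : ℂ),
      deriv (deriv (fun z => (z - p) ^ b * P (z - p))) u =
      deriv (deriv (fun t => t ^ b * P t)) (u - p) := fun b P u => by
    rw [funext (hshift b P)]
    exact deriv_comp_sub_const (f := deriv fun t => t ^ b * P t) p u
  have hana : ∀ (b : ℤ) (P : ℂ → ℂ), AnalyticAt ℂ (fun t => t ^ b * P t) t →
      AnalyticAt ℂ (fun z => (z - p) ^ b * P (z - p)) (p + t) := fun b P h =>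
    AnalyticAt.fun_comp (g := fun t => t ^ b * P t) (f := fun z => z - p) (by simpa using h)
      (by fun_prop)
  simp only [hshift, hshift2, add_sub_cancel_left, d1, d2, dd1, dd2, hU]
  refine ⟨hana _ _ a1, hana _ _ a2, ?_, ?_, ?_⟩
  · push_cast at e1 ⊢
    have := zpow_ne_zero (-(m : ℤ)) ht
    generalize t ^ (-(m : ℤ)) = T at *
    field_simp
    linear_combination t * e1
  · push_cast at e2 ⊢
    have := zpow_ne_zero ((m : ℤ) + 1) ht
    generalize t ^ ((m : ℤ) + 1) = T at *
    field_simp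
    linear_combination t * e2
  · have h3 : t ^ (-(m : ℤ)) * t ^ ((m : ℤ) + 1) = t := by
      rw [← zpow_add₀ ht]; simp
    convert hW using 1
    push_cast
    generalize t ^ (-(m : ℤ)) = T at *
    generalize t ^ ((m : ℤ) + 1) = S at *
    have h4 : t * t⁻¹ = 1 := mul_inv_cancel₀ ht
    linear_combination (P₁ t * ((m + 1) * t⁻¹ * P₂ t + deriv P₂ t) -
      (-m * t⁻¹ * P₁ t + deriv P₁ t) * P₂ t) * h3 +
      ((m + 1) * P₁ t * P₂ t + m * P₁ t * P₂ t) * h4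

open Filter Topology Metric in
/-- Analytic solutions of the Riccati equation `g ^ 2 - g' = U` near a point of a small punctured
disc continue meromorphically to the whole disc if `U` has trivial monodromy at its centre. -/
theorem TrivialMonodromyAt.exists_continuation {U : ℂ → ℂ} {p : ℂ} (hU : TrivialMonodromyAt U p) :
    ∃ r > 0, ∀ q ∈ ball p r, q ≠ p → ∀ g : ℂ → ℂ, AnalyticAt ℂ g q →
      (∀ᶠ z in 𝓝[≠] q, g z ^ 2 - deriv g z = U z) →
      ∃ G : ℂ → ℂ, (∀ z ∈ ball p r, MeromorphicAt G z ∧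
        ∀ᶠ y in 𝓝[≠] z, G y ^ 2 - deriv G y = U y) ∧ G =ᶠ[𝓝 q] g := by
  obtain ⟨φ₁, φ₂, hm1, hm2, hev⟩ := hU.exists_fundamental_system
  rw [eventually_nhdsWithin_iff] at hev
  obtain ⟨r, hr, hball⟩ := Metric.eventually_nhds_iff_ball.1 hev
  -- By linearity the radius depends on `U` alone, not on `g` or `q`.
  refine ⟨r, hr, fun q hq hqp g hg hgU => ?_⟩
  have hm1' : ∀ z ∈ ball p r, MeromorphicAt φ₁ z := fun z hz => by
    rcases eq_or_ne z p with rfl | hzp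
    · exact hm1
    · exact (hball z hz hzp).1.meromorphicAt
  have hm2' : ∀ z ∈ ball p r, MeromorphicAt φ₂ z := fun z hz => by
    rcases eq_or_ne z p with rfl | hzp
    · exact hm2
    · exact (hball z hz hzp).2.1.meromorphicAt
  obtain ⟨a1, a2, -, -, hW⟩ := hball q hq hqp
  set W := φ₁ q * deriv φ₂ q - deriv φ₁ q * φ₂ q
  -- Cramer's rule for `φ q = 1`, `φ' q = -g q`.
  set α := (deriv φ₂ q + g q * φ₂ q) / W with hα
  set β := (-g q * φ₁ q - deriv φ₁ q) / W with hβ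
  set φ : ℂ → ℂ := fun z => α * φ₁ z + β * φ₂ z with hφ
  have hφm : ∀ z ∈ ball p r, MeromorphicAt φ z := fun z hz =>
    ((MeromorphicAt.const α z).fun_mul (hm1' z hz)).fun_add
      ((MeromorphicAt.const β z).fun_mul (hm2' z hz))
  have hφa : ∀ z ∈ ball p r, z ≠ p → AnalyticAt ℂ φ z := fun z hz hzp => by
    obtain ⟨a1, a2, -⟩ := hball z hz hzp
    exact (analyticAt_const.mul a1).add (analyticAt_const.mul a2)
  have hφ1 : ∀ z ∈ ball p r, z ≠ p → deriv φ z = α * deriv φ₁ z + β * deriv φ₂ z :=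
    fun z hz hzp => by
    obtain ⟨a1, a2, -⟩ := hball z hz hzp
    exact ((a1.differentiableAt.hasDerivAt.const_mul α).fun_add
      (a2.differentiableAt.hasDerivAt.const_mul β)).deriv
  have hopen : ∀ z ∈ ball p r, z ≠ p → ∀ᶠ y in 𝓝 z, y ∈ ball p r ∧ y ≠ p := fun z hz hzp =>
    (isOpen_ball.eventually_mem hz).and (isOpen_ne.eventually_mem hzp)
  have hφ2 : ∀ z ∈ ball p r, z ≠ p → deriv (deriv φ) z = U z * φ z := fun z hz hzp => by
    obtain ⟨a1, a2, e1, e2, -⟩ := hball z hz hzp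
    have : deriv φ =ᶠ[𝓝 z] fun z => α * deriv φ₁ z + β * deriv φ₂ z := by
      filter_upwards [hopen z hz hzp] with y hy using hφ1 y hy.1 hy.2
    rw [this.deriv_eq, ((a1.deriv.differentiableAt.hasDerivAt.const_mul α).fun_add
      (a2.deriv.differentiableAt.hasDerivAt.const_mul β)).deriv, e1, e2, hφ]
    ring
  have hφq : φ q = 1 := by
    simp only [hφ, hα, hβ]
    field_simp
    simp only [W]
    ring
  have hφq1 : deriv φ q = -g q := by
    rw [hφ1 q hq hqp, hα, hβ]
    field_simp
    simp only [W]
    ring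
  have hne : ∀ z ∈ ball p r, ∀ᶠ y in 𝓝[≠] z, φ y ≠ 0 := by
    intro z hz
    rw [← meromorphicOrderAt_ne_top_iff_eventually_ne_zero (hφm z hz)]
    refine MeromorphicOn.meromorphicOrderAt_ne_top_of_isPreconnected (U := ball p r) hφm
      (convex_ball p r).isPreconnected hq hz ?_
    rw [meromorphicOrderAt_ne_top_iff_eventually_ne_zero (hφm q hq)]
    exact ((hφa q hq hqp).continuousAt.eventually_ne (by simp [hφq])).filter_mono
      nhdsWithin_le_nhds
  have hGU : ∀ z ∈ ball p r, ∀ᶠ y in 𝓝[≠] z,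
      (-(deriv φ y / φ y)) ^ 2 - deriv (fun y => -(deriv φ y / φ y)) y = U y := by
    intro z hz
    have hyp : ∀ᶠ y in 𝓝[≠] z, y ≠ p := by
      rcases eq_or_ne z p with rfl | hzp
      · exact self_mem_nhdsWithin
      · exact (isOpen_ne.eventually_mem hzp).filter_mono nhdsWithin_le_nhds
    filter_upwards [hne z hz, hyp, (isOpen_ball.eventually_mem hz).filter_mono nhdsWithin_le_nhds]
      with y h0 hyp hyb
    have ha := hφa y hyb hyp
    rw [(ha.deriv.differentiableAt.hasDerivAt.fun_div ha.differentiableAt.hasDerivAt h0).fun_neg.deriv,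
      hφ2 y hyb hyp]
    field_simp
    ring
  refine ⟨fun y => -(deriv φ y / φ y), fun z hz => ⟨?_, hGU z hz⟩, ?_⟩
  · exact ((hφm z hz).deriv.fun_div (hφm z hz)).fun_neg
  · have ha := hφa q hq hqp
    exact ((ha.deriv.div ha (by simp [hφq])).neg).eventuallyEq_of_riccati hg (hGU q hq) hgU
      (by simp [hφq, hφq1])

/-! ### Identity theorem along horizontal lines. -/

open Filter Topology in
theorem MeromorphicOn.eventuallyEq_of_isPreconnected {F₁ F₂ : ℂ → ℂ} {S : Set ℂ}
    (h₁ : MeromorphicOn F₁ S) (h₂ : MeromorphicOn F₂ S) (hS : IsPreconnected S) {x y : ℂ}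
    (hx : x ∈ S) (hy : y ∈ S) (h : F₁ =ᶠ[𝓝[≠] x] F₂) : F₁ =ᶠ[𝓝[≠] y] F₂ := by
  have hd : MeromorphicOn (F₁ - F₂) S := fun z hz => (h₁ z hz).sub (h₂ z hz)
  have hxt : meromorphicOrderAt (F₁ - F₂) x = ⊤ := by
    rw [meromorphicOrderAt_eq_top_iff]
    filter_upwards [h] with z hz using sub_eq_zero.2 hz
  by_contra hne
  refine hd.meromorphicOrderAt_ne_top_of_isPreconnected hS hy hx (fun hyt => hne ?_) hxt
  rw [meromorphicOrderAt_eq_top_iff] at hyt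
  filter_upwards [hyt] with z hz using sub_eq_zero.1 hz

theorem continuous_mk_im (ξ : ℝ) : Continuous fun t : ℝ => (⟨t, ξ⟩ : ℂ) := by
  have : (fun t : ℝ => (⟨t, ξ⟩ : ℂ)) = fun t : ℝ => (t : ℂ) + ξ * I := by
    funext t
    rw [← Complex.mk_eq_add_mul_I]
  rw [this]
  fun_prop

theorem mk_add_ofReal (t ξ a : ℝ) : (⟨t, ξ⟩ : ℂ) + a = ⟨t + a, ξ⟩ := by
  apply Complex.ext <;> simp

open Filter Topology in
/-- Meromorphic continuations from one point to another along a horizontal segment are unique. -/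
theorem eventuallyEq_of_horizontal {F₁ F₂ : ℂ → ℂ} {ξ s t : ℝ} {J : Set ℝ} (hJ : J.OrdConnected)
    (h₁ : ∀ u ∈ J, MeromorphicAt F₁ ⟨u, ξ⟩) (h₂ : ∀ u ∈ J, MeromorphicAt F₂ ⟨u, ξ⟩)
    (hs : s ∈ J) (ht : t ∈ J) (h : F₁ =ᶠ[𝓝[≠] ⟨s, ξ⟩] F₂) : F₁ =ᶠ[𝓝[≠] ⟨t, ξ⟩] F₂ := by
  refine MeromorphicOn.eventuallyEq_of_isPreconnected (S := (fun t : ℝ => (⟨t, ξ⟩ : ℂ)) '' J)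
    ?_ ?_ (hJ.isPreconnected.image _ (continuous_mk_im ξ).continuousOn) ⟨s, hs, rfl⟩ ⟨t, ht, rfl⟩ h
  · rintro _ ⟨u, hu, rfl⟩
    exact h₁ u hu
  · rintro _ ⟨u, hu, rfl⟩
    exact h₂ u hu

open Filter Topology in
theorem exists_mem_Ioo_of_eventually_nhdsNE {P : ℂ → Prop} {l u t ξ : ℝ} (ht : t ∈ Set.Ioo l u)
    (hP : ∀ᶠ z in 𝓝[≠] (⟨t, ξ⟩ : ℂ), P z) : ∃ s ∈ Set.Ioo l u, P ⟨s, ξ⟩ := by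
  have h1 : Tendsto (fun s : ℝ => (⟨s, ξ⟩ : ℂ)) (𝓝[≠] t) (𝓝[≠] ⟨t, ξ⟩) := by
    refine tendsto_nhdsWithin_iff.2 ⟨(continuous_mk_im ξ).continuousAt.mono_left
      nhdsWithin_le_nhds, ?_⟩
    filter_upwards [self_mem_nhdsWithin] with s hs h
    exact hs (congrArg Complex.re h)
  obtain ⟨s, hs1, hs2⟩ := ((h1.eventually hP).and
    ((isOpen_Ioo.eventually_mem ht).filter_mono nhdsWithin_le_nhds)).exists
  exact ⟨s, hs2, hs1⟩

open Filter Topology in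
theorem eventually_nhds_add_iff (p a : ℂ) {P : ℂ → Prop} :
    (∀ᶠ z in 𝓝 (p + a), P z) ↔ ∀ᶠ z in 𝓝 p, P (z + a) := by
  rw [← map_add_right_nhds]
  rfl

/-! ### Continuation to the right along one line. -/

open Filter Topology in
/-- `F` continues the germ of `f` at `c + ξ * I` along the horizontal line `Im = ξ`, from the
abscissa `x₀` to the abscissa `X`, as a solution of the differential-difference equation. -/
structure IsLineContinuation (a : ℝ) (μ : ℂ) (f : ℂ → ℂ) (ξ x₀ c X : ℝ) (F : ℂ → ℂ) : Prop where
  oddPolarAt : ∀ t ∈ Set.Ioo x₀ X, OddPolarAt F ⟨t, ξ⟩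
  agree : F =ᶠ[𝓝[≠] ⟨c, ξ⟩] f
  equation : ∀ t ∈ Set.Ioo x₀ (X - a), ∀ᶠ z in 𝓝[≠] (⟨t, ξ⟩ : ℂ),
    deriv F z + deriv (fun y => F (y + a)) z + F z ^ 2 - F (z + a) ^ 2 = μ

open Filter Topology in
theorem IsLineContinuation.exists_gt {a : ℝ} (ha : 0 < a) {μ : ℂ} {f : ℂ → ℂ} {ξ x₀ c T : ℝ}
    (hc : x₀ < c) (hT : c + a < T)
    (h : ∀ X < T, ∃ F, IsLineContinuation a μ f ξ x₀ c X F) :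
    ∃ T' > T, ∃ F, IsLineContinuation a μ f ξ x₀ c T' F := by
  -- `F₀` reaches past `T - a` and so fixes the potential and the radius `r` there; only then is
  -- `F₁` chosen, reaching as close to `T` as `r` demands.
  obtain ⟨F₀, hF₀⟩ := h (T - a / 2) (by linarith)
  have hp := (hF₀.oddPolarAt (T - a) ⟨by linarith, by linarith⟩).trivialMonodromyAt μ
  obtain ⟨r, hr, hcont⟩ := hp.exists_continuation
  obtain ⟨δ, hδ, hδr, hδa, hδc⟩ : ∃ δ : ℝ, 0 < δ ∧ δ ≤ r ∧ δ ≤ a / 2 ∧ δ ≤ T - a - c :=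
    ⟨min r (min (a / 2) (T - a - c)), by
      refine lt_min hr (lt_min ?_ ?_) <;> linarith, by simp, by simp, by simp⟩
  obtain ⟨F₁, hF₁⟩ := h (T - δ / 4) (by linarith)
  have hF₁₀ : ∀ t ∈ Set.Ioo x₀ (T - a / 2), F₁ =ᶠ[𝓝[≠] ⟨t, ξ⟩] F₀ := fun t ht =>
    eventuallyEq_of_horizontal (J := Set.Ioo x₀ (T - a / 2)) Set.ordConnected_Ioo
      (fun u hu => (hF₁.oddPolarAt u ⟨hu.1, by linarith [hu.2]⟩).meromorphicAt)
      (fun u hu => (hF₀.oddPolarAt u hu).meromorphicAt) (s := c) ⟨hc, by linarith⟩ ht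
      (hF₁.agree.trans hF₀.agree.symm)
  -- The joining abscissa avoids the poles of `F₁`, and `τ - a` lies in the disc about `T - a`, away
  -- from its centre.
  obtain ⟨τ, ⟨hτ1, hτ2⟩, hτa⟩ := exists_mem_Ioo_of_eventually_nhdsNE
    (l := T - δ / 2) (u := T - δ / 4) (t := T - 3 * δ / 8) (ξ := ξ)
    ⟨by linarith, by linarith⟩ (hF₁.oddPolarAt (T - 3 * δ / 8)
      ⟨by linarith, by linarith⟩).meromorphicAt.eventually_analyticAt
  have hball : ∀ s : ℝ, |s - (T - a)| < r → (⟨s, ξ⟩ : ℂ) ∈ Metric.ball (⟨T - a, ξ⟩ : ℂ) r := by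
    intro s hs
    rw [Metric.mem_ball, Complex.dist_of_im_eq (z := ⟨s, ξ⟩) (w := ⟨T - a, ξ⟩) rfl]
    exact hs
  have hg : AnalyticAt ℂ (fun z => F₁ (z + a)) ⟨τ - a, ξ⟩ :=
    AnalyticAt.fun_comp (f := fun z : ℂ => z + a)
      (by rw [mk_add_ofReal, sub_add_cancel]; exact hτa) (by fun_prop)
  obtain ⟨G, hG, hGg⟩ := hcont ⟨τ - a, ξ⟩
    (hball _ (by rw [abs_lt]; constructor <;> linarith))
    (fun h => by have := congrArg Complex.re h; simp at this; linarith)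
    (fun z => F₁ (z + a)) hg (by
      have h1 := hF₁₀ (τ - a) ⟨by linarith, by linarith⟩
      filter_upwards [hF₁.equation (τ - a) ⟨by linarith, by linarith⟩, h1, h1.nhdsNE_deriv]
        with z e1 e2 e3
      rw [e2, e3] at e1
      linear_combination -e1)
  -- `F₁` and the translate of `G` agree near `⟨τ, ξ⟩`, so the cut produces no discontinuity near
  -- the line `Im = ξ`.
  set F : ℂ → ℂ := fun z => if z.re < τ then F₁ z else G (z - a) with hF
  have hGF₁ : (fun z => G (z - a)) =ᶠ[𝓝 ⟨τ, ξ⟩] F₁ := by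
    have h1 : (⟨τ, ξ⟩ : ℂ) = ⟨τ - a, ξ⟩ + (a : ℂ) := by rw [mk_add_ofReal, sub_add_cancel]
    rw [h1]
    refine (eventually_nhds_add_iff _ _).2 ?_
    filter_upwards [hGg] with z hz
    rw [add_sub_cancel_right, hz]
  have hleft : ∀ t ≤ τ, F =ᶠ[𝓝 ⟨t, ξ⟩] F₁ := by
    intro t ht
    rcases ht.lt_or_eq with ht | rfl
    · filter_upwards [(isOpen_lt continuous_re continuous_const).mem_nhds
        (show (⟨t, ξ⟩ : ℂ).re < τ from ht)] with z hz
      exact if_pos hz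
    · filter_upwards [hGF₁] with z hz
      simp only [hF]
      split_ifs
      · rfl
      · exact hz
  have hright : ∀ t ≥ τ, F =ᶠ[𝓝 ⟨t, ξ⟩] fun z => G (z - a) := by
    intro t ht
    rcases ht.lt_or_eq with ht | rfl
    · filter_upwards [(isOpen_lt continuous_const continuous_re).mem_nhds
        (show τ < (⟨t, ξ⟩ : ℂ).re from ht)] with z hz
      exact if_neg (not_lt.2 (le_of_lt hz))
    · exact (hleft _ le_rfl).trans hGF₁.symm
  refine ⟨T + δ / 2, by linarith, F, ⟨fun t ht => ?_, ?_, fun t ht => ?_⟩⟩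
  · rcases le_total t τ with htτ | htτ
    · exact (hF₁.oddPolarAt t ⟨ht.1, by linarith⟩).congr
        ((hleft t htτ).symm.filter_mono nhdsWithin_le_nhds)
    · have hb := hball (t - a) (by rw [abs_lt]; constructor <;> linarith [ht.2])
      have h1 := (hF₀.oddPolarAt (t - a)
        ⟨by linarith, by linarith [ht.2]⟩).trivialMonodromyAt μ
      have h2 := h1.oddPolarAt_of_riccati (hG _ hb).1 (hG _ hb).2
      have h3 : (⟨t, ξ⟩ : ℂ) + ((-a : ℝ) : ℂ) = ⟨t - a, ξ⟩ := mk_add_ofReal t ξ (-a)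
      rw [← h3] at h2
      refine h2.comp_add_const.congr ?_
      simp only [ofReal_neg, ← sub_eq_add_neg]
      exact (hright t htτ).symm.filter_mono nhdsWithin_le_nhds
  · exact ((hleft c (by linarith)).filter_mono nhdsWithin_le_nhds).trans hF₁.agree
  · have hFF₁ : F =ᶠ[𝓝[≠] ⟨t, ξ⟩] F₁ :=
      (hleft t (by linarith [ht.2])).filter_mono nhdsWithin_le_nhds
    rcases le_total (t + a) τ with htτ | htτ
    · have h1 : (fun z => F (z + a)) =ᶠ[𝓝[≠] ⟨t, ξ⟩] fun z => F₁ (z + a) := by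
        refine Filter.EventuallyEq.filter_mono ?_ nhdsWithin_le_nhds
        refine (eventually_nhds_add_iff _ _ (P := fun z => F z = F₁ z)).1 ?_
        rw [mk_add_ofReal]
        exact hleft _ htτ
      filter_upwards [hFF₁, hFF₁.nhdsNE_deriv, h1, h1.nhdsNE_deriv,
        hF₁.equation t ⟨ht.1, by linarith⟩] with z e1 e2 e3 e4 e5
      rw [e1, e2, e3, e4, e5]
    · have h1 : (fun z => F (z + a)) =ᶠ[𝓝[≠] ⟨t, ξ⟩] G := by
        refine Filter.EventuallyEq.filter_mono ?_ nhdsWithin_le_nhds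
        have h2 := hright _ htτ
        rw [← mk_add_ofReal] at h2
        filter_upwards [(eventually_nhds_add_iff _ _).1 h2] with z hz
        rw [hz, add_sub_cancel_right]
      have h2 := hFF₁.trans (hF₁₀ t ⟨ht.1, by linarith [ht.2]⟩)
      have hb := hball t (by rw [abs_lt]; constructor <;> linarith [ht.2])
      filter_upwards [h2, h2.nhdsNE_deriv, h1, h1.nhdsNE_deriv, (hG _ hb).2] with z e1 e2 e3 e4 e5
      rw [e1, e2, e3, e4]
      linear_combination -e5

theorem IsLineContinuation.mono {a : ℝ} {μ : ℂ} {f : ℂ → ℂ} {ξ x₀ c X X' : ℝ} {F : ℂ → ℂ}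
    (hF : IsLineContinuation a μ f ξ x₀ c X F) (h : X' ≤ X) :
    IsLineContinuation a μ f ξ x₀ c X' F :=
  ⟨fun t ht => hF.oddPolarAt t ⟨ht.1, ht.2.trans_le h⟩, hF.agree,
    fun t ht => hF.equation t ⟨ht.1, by linarith [ht.2]⟩⟩

theorem IsLineContinuation.exists_forall {a : ℝ} (ha : 0 < a) {μ : ℂ} {f : ℂ → ℂ}
    {ξ x₀ c x₁ : ℝ} (hc : x₀ < c) (hx₁ : c + a < x₁)
    (hf : IsLineContinuation a μ f ξ x₀ c x₁ f) (X : ℝ) :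
    ∃ F, IsLineContinuation a μ f ξ x₀ c X F := by
  set S : Set ℝ := {X | ∃ F, IsLineContinuation a μ f ξ x₀ c X F} with hS
  have hlt : ∀ X ∈ S, ∀ X' ≤ X, X' ∈ S := fun X ⟨F, hF⟩ X' h => ⟨F, hF.mono h⟩
  have hmem : x₁ ∈ S := ⟨f, hf⟩
  by_contra hX
  have hbdd : BddAbove S := ⟨X, fun Y hY => not_lt.1 fun h => hX (hlt Y hY X h.le)⟩
  obtain ⟨T', hT', hmem'⟩ := IsLineContinuation.exists_gt ha hc
    (hx₁.trans_le (le_csSup hbdd hmem)) fun Y hY => by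
      obtain ⟨Z, hZ, hYZ⟩ := exists_lt_of_lt_csSup ⟨x₁, hmem⟩ hY
      exact hlt Z hZ Y hYZ.le
  exact (le_csSup hbdd hmem').not_gt hT'

/-! ### Reflection, horizontal sections of the domain, and the initial data. -/

open Filter Topology in
theorem eventually_nhdsNE_neg {p : ℂ} {P : ℂ → Prop} (h : ∀ᶠ z in 𝓝[≠] (-p), P z) :
    ∀ᶠ z in 𝓝[≠] p, P (-z) := by
  rw [eventually_nhdsWithin_iff] at h ⊢
  filter_upwards [(continuous_neg.tendsto p).eventually h] with z hz hzp
  exact hz (by simpa using hzp)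

theorem neg_mk (t ξ : ℝ) : -(⟨t, ξ⟩ : ℂ) = ⟨-t, -ξ⟩ := by
  apply Complex.ext <;> simp

theorem OddPolarAt.comp_neg {f : ℂ → ℂ} {p : ℂ} (hf : OddPolarAt f (-p)) :
    OddPolarAt (fun z => f (-z)) p := by
  obtain ⟨n, h, e, hh, he, hfh, hhe⟩ := hf
  refine ⟨-n, fun t => h (-t), e, hh.comp_neg_zero, he, ?_, ?_⟩
  · filter_upwards [eventually_nhdsNE_neg (p := 0) (by simpa using hfh)] with t ht
    rw [neg_add, ht]
    push_cast
    rw [div_neg, neg_div]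
  · filter_upwards [hhe] with t ht
    rw [Int.natAbs_neg, ← ht, neg_neg, add_comm]

theorem IsDomainBetween.ordConnected_section {R : Set ℂ} {η₁ η₂ : ℝ → EReal}
    (hR : IsDomainBetween R η₁ η₂) (ξ : ℝ) : {t : ℝ | (⟨t, ξ⟩ : ℂ) ∈ R}.OrdConnected := by
  refine ⟨fun s hs t ht u hu => ?_⟩
  simp only [Set.mem_ofPred_eq, hR.eq_region, curveRegion] at hs ht ⊢
  exact ⟨hs.1.trans_le (EReal.coe_le_coe_iff.2 hu.1),
    (EReal.coe_le_coe_iff.2 hu.2).trans_lt ht.2⟩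

theorem IsDomainBetween.exists_wide_section {R : Set ℂ} {η₁ η₂ : ℝ → EReal}
    (hR : IsDomainBetween R η₁ η₂) {a ξ : ℝ} (h : (a : EReal) < η₂ ξ - η₁ ξ) :
    ∃ x₀ x₁ : ℝ, x₀ + a < x₁ ∧ ∀ t ∈ Set.Icc x₀ x₁, (⟨t, ξ⟩ : ℂ) ∈ R := by
  suffices ∃ x₀ x₁ : ℝ, x₀ + a < x₁ ∧ η₁ ξ < x₀ ∧ (x₁ : EReal) < η₂ ξ by
    obtain ⟨x₀, x₁, h01, h0, h1⟩ := this
    refine ⟨x₀, x₁, h01, fun t ht => ?_⟩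
    rw [hR.eq_region]
    exact ⟨h0.trans_le (EReal.coe_le_coe_iff.2 ht.1), (EReal.coe_le_coe_iff.2 ht.2).trans_lt h1⟩
  have hlt := hR.lt ξ
  generalize η₁ ξ = u at *
  generalize η₂ ξ = v at *
  induction u with
  | top => exact absurd hlt not_top_lt
  | bot =>
    obtain ⟨x₁, -, hx₁⟩ := EReal.lt_iff_exists_real_btwn.1 hlt
    exact ⟨x₁ - a - 1, x₁, by linarith, EReal.bot_lt_coe _, hx₁⟩
  | coe u =>
    induction v with
    | bot => exact absurd hlt not_lt_bot
    | top => exact ⟨u + 1, u + 1 + a + 1, by linarith, by exact_mod_cast lt_add_one u,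
        EReal.coe_lt_top _⟩
    | coe v =>
      have h' : a < v - u := by exact_mod_cast h
      refine ⟨u + (v - u - a) / 3, v - (v - u - a) / 3, by linarith, ?_, ?_⟩
      · exact_mod_cast (by linarith : u < u + (v - u - a) / 3)
      · exact_mod_cast (by linarith : v - (v - u - a) / 3 < v)

theorem IsAnalyticDDESolution.deriv_add {a : ℝ} {μ : ℂ} {R : Set ℂ} {f : ℂ → ℂ}
    (hf : IsAnalyticDDESolution a μ R f) {z : ℂ} (hz : z ∈ R) (hza : z + a ∈ R) :
    deriv f z + deriv f (z + a) + f z ^ 2 - f (z + a) ^ 2 = μ := by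
  rw [← hf.equation z hz hza, deriv_fun_add (hf.analytic z hz).differentiableAt,
    deriv_comp_add_const]
  exact (hf.analytic (z + a) hza).differentiableAt.fun_comp' z (by fun_prop)

open Filter Topology in
theorem IsAnalyticDDESolution.isLineContinuation {a : ℝ} {μ : ℂ} {R : Set ℂ} {f : ℂ → ℂ}
    (hRo : IsOpen R) (hf : IsAnalyticDDESolution a μ R f) {ξ x₀ x₁ c : ℝ} (ha : 0 < a)
    (hR : ∀ t ∈ Set.Icc x₀ x₁, (⟨t, ξ⟩ : ℂ) ∈ R) : IsLineContinuation a μ f ξ x₀ c x₁ f := by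
  refine ⟨fun t ht => (hf.analytic _ (hR t ⟨ht.1.le, ht.2.le⟩)).oddPolarAt, EventuallyEq.rfl,
    fun t ht => Eventually.filter_mono nhdsWithin_le_nhds ?_⟩
  filter_upwards [hRo.mem_nhds (hR t ⟨ht.1.le, by linarith [ht.2]⟩),
    (eventually_nhds_add_iff _ _).1 (hRo.mem_nhds (x := (⟨t, ξ⟩ : ℂ) + a)
      (by rw [mk_add_ofReal]; exact hR _ ⟨by linarith [ht.1], by linarith [ht.2]⟩))] with z h1 h2
  rw [deriv_comp_add_const]
  exact hf.deriv_add h1 h2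

/-- Reflection exchanges the roles of `x` and `x + a`, whence the sign of `μ`; it turns continuation
to the left into continuation to the right. -/
theorem IsAnalyticDDESolution.comp_neg {a : ℝ} {μ : ℂ} {R : Set ℂ} {f : ℂ → ℂ}
    (hf : IsAnalyticDDESolution a μ R f) :
    IsAnalyticDDESolution a (-μ) (-R) (fun z => f (-z)) := by
  have hana : AnalyticOnNhd ℂ (fun z => f (-z)) (-R) := fun z hz =>
    AnalyticAt.fun_comp (f := fun z => -z) (hf.analytic _ hz) analyticAt_id.neg
  refine ⟨hana, fun z hz hza => ?_⟩
  have h1 := hf.deriv_add (z := -(z + a)) hza (by simpa using hz)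
  have h2 : HasDerivAt (fun y : ℂ => f (-(y + a))) (-deriv f (-(z + a))) z := by
    simpa [Function.comp_def] using
      HasDerivAt.comp z (hf.analytic _ hza).differentiableAt.hasDerivAt
        ((hasDerivAt_id' z).add_const (a : ℂ)).fun_neg
  have h3 : HasDerivAt (fun y : ℂ => f (-y)) (-deriv f (-z)) z := by
    simpa [Function.comp_def] using
      HasDerivAt.comp z (hf.analytic _ hz).differentiableAt.hasDerivAt (hasDerivAt_neg z)
  rw [(h3.fun_add h2).deriv]
  rw [show -(z + a) + a = -z by ring] at h1
  linear_combination -h1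

/-! ### Gluing the horizontal germs. -/

open Filter Topology in
/-- `F` represents at `z` the germ obtained from `f` by meromorphic continuation along a horizontal
segment issuing from a point of `R`, with at most a simple pole at `z`. -/
def IsHorizontalGerm (R : Set ℂ) (f : ℂ → ℂ) (z : ℂ) (F : ℂ → ℂ) : Prop :=
  ∃ b : ℝ, (⟨b, z.im⟩ : ℂ) ∈ R ∧ (∀ t ∈ Set.uIcc b z.re, MeromorphicAt F ⟨t, z.im⟩) ∧
    F =ᶠ[𝓝[≠] ⟨b, z.im⟩] f ∧ ((-1 : ℤ) : WithTop ℤ) ≤ meromorphicOrderAt F z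

theorem IsHorizontalGerm.meromorphicAt {R : Set ℂ} {f F : ℂ → ℂ} {z : ℂ}
    (h : IsHorizontalGerm R f z F) : MeromorphicAt F z := by
  obtain ⟨b, -, h, -⟩ := h
  exact h z.re Set.right_mem_uIcc

open Filter Topology in
theorem IsAnalyticDDESolution.exists_isHorizontalGerm {a : ℝ} {μ : ℂ} {R : Set ℂ} {f : ℂ → ℂ}
    (hRo : IsOpen R) (hf : IsAnalyticDDESolution a μ R f) (ha : 0 < a) {x₀ x₁ : ℝ} {z : ℂ}
    (h01 : x₀ + a < x₁) (hR : ∀ t ∈ Set.Icc x₀ x₁, (⟨t, z.im⟩ : ℂ) ∈ R) :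
    ∃ F, IsHorizontalGerm R f z F := by
  -- Continuation to the right starts at `c`, the reflected one at `c + a`; both leave more than `a`
  -- of known section ahead.
  obtain ⟨c, hc0, hc1⟩ : ∃ c, x₀ < c ∧ c + a < x₁ :=
    ⟨(x₀ + x₁ - a) / 2, by linarith, by linarith⟩
  rcases le_or_gt c z.re with hz | hz
  · obtain ⟨F, hF⟩ := (hf.isLineContinuation hRo ha hR (c := c)).exists_forall ha hc0 hc1 (z.re + 1)
    refine ⟨F, c, hR c ⟨hc0.le, by linarith⟩, fun t ht => ?_, hF.agree,
      (hF.oddPolarAt z.re ⟨by linarith, by linarith⟩).neg_one_le_meromorphicOrderAt⟩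
    rw [Set.uIcc_of_le hz] at ht
    exact (hF.oddPolarAt t ⟨by linarith [ht.1], by linarith [ht.2]⟩).meromorphicAt
  · have hR' : ∀ t ∈ Set.Icc (-x₁) (-x₀), (⟨t, -z.im⟩ : ℂ) ∈ -R := by
      intro t ht
      rw [Set.mem_neg, neg_mk, neg_neg]
      exact hR _ ⟨by linarith [ht.2], by linarith [ht.1]⟩
    obtain ⟨G, hG⟩ := (hf.comp_neg.isLineContinuation hRo.neg ha hR'
      (c := -(c + a))).exists_forall ha (by linarith) (by linarith) (-z.re + 1)
    have hodd : ∀ t ∈ Set.Icc z.re (c + a), OddPolarAt (fun y => G (-y)) ⟨t, z.im⟩ := by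
      intro t ht
      refine OddPolarAt.comp_neg ?_
      rw [neg_mk]
      exact hG.oddPolarAt _ ⟨by linarith [ht.2], by linarith [ht.1]⟩
    refine ⟨fun y => G (-y), c + a, hR _ ⟨by linarith, hc1.le⟩, fun t ht => ?_, ?_,
      (hodd z.re ⟨le_rfl, by linarith⟩).neg_one_le_meromorphicOrderAt⟩
    · rw [Set.uIcc_of_ge (by linarith)] at ht
      exact (hodd t ht).meromorphicAt
    · have := hG.agree
      rw [← neg_mk] at this
      filter_upwards [eventually_nhdsNE_neg this] with y hy
      rw [hy, neg_neg]

open Filter Topology in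
theorem IsHorizontalGerm.eventuallyEq {R : Set ℂ} {f F₁ F₂ : ℂ → ℂ} {z : ℂ}
    (hR : {t : ℝ | (⟨t, z.im⟩ : ℂ) ∈ R}.OrdConnected) (hf : AnalyticOnNhd ℂ f R)
    (h₁ : IsHorizontalGerm R f z F₁) (h₂ : IsHorizontalGerm R f z F₂) : F₁ =ᶠ[𝓝[≠] z] F₂ := by
  have key : ∀ {F : ℂ → ℂ} {b s : ℝ}, (⟨b, z.im⟩ : ℂ) ∈ R → (⟨s, z.im⟩ : ℂ) ∈ R →
      (∀ t ∈ Set.uIcc b z.re, MeromorphicAt F ⟨t, z.im⟩) → F =ᶠ[𝓝[≠] ⟨b, z.im⟩] f →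
      s ∈ Set.uIcc b z.re → F =ᶠ[𝓝[≠] ⟨s, z.im⟩] f := fun {F b s} hb hs hF hbf hsb =>
    eventuallyEq_of_horizontal (J := Set.uIcc b z.re ∩ {t : ℝ | (⟨t, z.im⟩ : ℂ) ∈ R})
      (Set.ordConnected_uIcc.inter hR) (fun u hu => hF u hu.1)
      (fun u hu => (hf _ hu.2).meromorphicAt) ⟨Set.left_mem_uIcc, hb⟩ ⟨hsb, hs⟩ hbf
  obtain ⟨b₁, hb₁, hm₁, he₁, -⟩ := h₁
  obtain ⟨b₂, hb₂, hm₂, he₂, -⟩ := h₂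
  -- One of the three abscissae lies between the other two. Since the section of `R` is an interval,
  -- both germs can be compared with `f` at that middle point.
  have hcases : b₁ ∈ Set.uIcc b₂ z.re ∨ b₂ ∈ Set.uIcc b₁ z.re ∨ z.re ∈ Set.uIcc b₁ b₂ := by
    simp only [Set.mem_uIcc]
    grind
  rcases hcases with h | h | h
  · exact eventuallyEq_of_horizontal (J := Set.uIcc b₁ z.re) (t := z.re) Set.ordConnected_uIcc hm₁
      (fun u hu => hm₂ u (Set.uIcc_subset_uIcc h Set.right_mem_uIcc hu)) Set.left_mem_uIcc
      Set.right_mem_uIcc (he₁.trans (key hb₂ hb₁ hm₂ he₂ h).symm)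
  · exact eventuallyEq_of_horizontal (J := Set.uIcc b₂ z.re) (t := z.re) Set.ordConnected_uIcc
      (fun u hu => hm₁ u (Set.uIcc_subset_uIcc h Set.right_mem_uIcc hu)) hm₂ Set.left_mem_uIcc
      Set.right_mem_uIcc ((key hb₁ hb₂ hm₁ he₁ h).trans he₂.symm)
  · have hz : (⟨z.re, z.im⟩ : ℂ) ∈ R := hR.uIcc_subset hb₁ hb₂ h
    exact (key hb₁ hz hm₁ he₁ Set.right_mem_uIcc).trans (key hb₂ hz hm₂ he₂ Set.right_mem_uIcc).symm

open Filter Topology in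
theorem eventually_eventually_nhdsNE_of_nhdsNE {p : ℂ} {P : ℂ → Prop} (h : ∀ᶠ z in 𝓝[≠] p, P z) :
    ∀ᶠ y in 𝓝 p, ∀ᶠ z in 𝓝[≠] y, P z := by
  have h1 := eventually_nhdsWithin_iff.1 (eventually_eventually_nhdsWithin.2 h)
  filter_upwards [h1] with y hy
  rcases eq_or_ne y p with rfl | hyp
  · exact h
  · have h2 := hy hyp
    rw [nhdsWithin_eq_nhds.2 (isOpen_compl_singleton.mem_nhds hyp)] at h2
    exact h2.filter_mono nhdsWithin_le_nhds

open Filter Topology in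
theorem MeromorphicAt.eventually_meromorphicAt {F : ℂ → ℂ} {p : ℂ} (h : MeromorphicAt F p) :
    ∀ᶠ y in 𝓝 p, MeromorphicAt F y := by
  filter_upwards [eventually_nhdsWithin_iff.1 h.eventually_analyticAt] with y hy
  rcases eq_or_ne y p with rfl | hyp
  · exact h
  · exact (hy hyp).meromorphicAt

-- Meromorphy is an open condition and the segment is compact, so the same `F` and base abscissa
-- serve all nearby points. Puncturing the neighbourhood makes `F` analytic at `y`, which supplies
-- the bound on the order.
open Filter Topology in
theorem IsHorizontalGerm.eventually {R : Set ℂ} (hRo : IsOpen R) {f F : ℂ → ℂ} {z : ℂ}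
    (h : IsHorizontalGerm R f z F) :
    ∀ᶠ y in 𝓝[≠] z, IsHorizontalGerm R f y F ∧ AnalyticAt ℂ F y := by
  have hF := h.meromorphicAt
  obtain ⟨b, hb, hm, he, hord⟩ := h
  have hmk : Continuous fun y : ℂ => (⟨b, y.im⟩ : ℂ) := by
    have : (fun y : ℂ => (⟨b, y.im⟩ : ℂ)) = fun y : ℂ => (b : ℂ) + y.im * I := by
      funext y
      rw [← Complex.mk_eq_add_mul_I]
    rw [this]
    fun_prop
  have hseg : ∀ᶠ y in 𝓝 z, ∀ θ ∈ Set.Icc (0 : ℝ) 1,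
      MeromorphicAt F ⟨b + θ * (y.re - b), y.im⟩ := by
    have hcont : Continuous fun q : ℂ × ℝ => (⟨b + q.2 * (q.1.re - b), q.1.im⟩ : ℂ) := by
      have : (fun q : ℂ × ℝ => (⟨b + q.2 * (q.1.re - b), q.1.im⟩ : ℂ)) =
          fun q : ℂ × ℝ => ((b + q.2 * (q.1.re - b) : ℝ) : ℂ) + q.1.im * I := by
        funext q
        rw [← Complex.mk_eq_add_mul_I]
      rw [this]
      fun_prop
    refine isCompact_Icc.eventually_forall_of_forall_eventually fun θ hθ => ?_
    refine (hcont.tendsto (z, θ)).eventually (MeromorphicAt.eventually_meromorphicAt (hm _ ?_))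
    rw [← segment_eq_uIcc, segment_eq_image']
    exact ⟨θ, hθ, rfl⟩
  filter_upwards [hseg.filter_mono nhdsWithin_le_nhds,
    ((hmk.tendsto z).eventually (hRo.mem_nhds hb)).filter_mono nhdsWithin_le_nhds,
    ((hmk.tendsto z).eventually (eventually_eventually_nhdsNE_of_nhdsNE he)).filter_mono
      nhdsWithin_le_nhds, hF.eventually_analyticAt] with y h1 h2 h3 h4
  refine ⟨⟨b, h2, fun t ht => ?_, h3, ?_⟩, h4⟩
  · rw [← segment_eq_uIcc, segment_eq_image'] at ht
    obtain ⟨θ, hθ, rfl⟩ := ht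
    exact h1 θ hθ
  · exact le_trans (by decide) h4.meromorphicOrderAt_nonneg

open Classical in
/-- The function whose values are those of the horizontal continuations of `f`, in normal form. -/
noncomputable def horizontalContinuation (R : Set ℂ) (f : ℂ → ℂ) (z : ℂ) : ℂ :=
  if h : ∃ F, IsHorizontalGerm R f z F then toMeromorphicNFAt h.choose z z else f z

open Filter Topology in
theorem IsHorizontalGerm.horizontalContinuation_eq {R : Set ℂ} {f F : ℂ → ℂ} {z : ℂ}
    (hR : {t : ℝ | (⟨t, z.im⟩ : ℂ) ∈ R}.OrdConnected) (hf : AnalyticOnNhd ℂ f R)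
    (h : IsHorizontalGerm R f z F) :
    horizontalContinuation R f z = toMeromorphicNFAt F z z := by
  have hex : ∃ F, IsHorizontalGerm R f z F := ⟨F, h⟩
  rw [horizontalContinuation, dif_pos hex]
  exact (toMeromorphicNFAt_eventuallyEq_nhds_congr
    (hex.choose_spec.eventuallyEq hR hf h)).self_of_nhds

open Filter Topology in
theorem IsHorizontalGerm.horizontalContinuation_eventuallyEq {R : Set ℂ} {f F : ℂ → ℂ} {z : ℂ}
    (hR : ∀ ξ : ℝ, {t : ℝ | (⟨t, ξ⟩ : ℂ) ∈ R}.OrdConnected) (hRo : IsOpen R)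
    (hf : AnalyticOnNhd ℂ f R) (h : IsHorizontalGerm R f z F) :
    horizontalContinuation R f =ᶠ[𝓝 z] toMeromorphicNFAt F z := by
  filter_upwards [eventually_nhdsWithin_iff.1 (h.eventually hRo)] with y hy
  rcases eq_or_ne y z with rfl | hyz
  · exact h.horizontalContinuation_eq (hR _) hf
  · obtain ⟨h1, h2⟩ := hy hyz
    rw [h1.horizontalContinuation_eq (hR _) hf, toMeromorphicNFAt_eq_self.2 h2.meromorphicNFAt,
      h.meromorphicAt.eqOn_compl_singleton_toMeromorphicNFAt hyz]

theorem mainTheorem5 (a : ℝ) (ha : 0 < a) (μ : ℂ) (I : Set ℝ) (hI : I.OrdConnected)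
    (R : Set ℂ) (hR : IsWideDomainOn a I R)
    (f : ℂ → ℂ) (hf : IsAnalyticDDESolution a μ R f) :
    ∃ F : ℂ → ℂ,
      Set.EqOn F f R ∧
      MeromorphicOn F {x : ℂ | x.im ∈ I} ∧
      ∀ x : ℂ, x.im ∈ I → ¬ AnalyticAt ℂ F x →
        meromorphicOrderAt F x = ((-1 : ℤ) : WithTop ℤ) := by
  obtain ⟨η₁, η₂, hdom, hwide⟩ := hR
  have hgerm : ∀ x : ℂ, x.im ∈ I → ∃ F, IsHorizontalGerm R f x F := fun x hx => by
    obtain ⟨x₀, x₁, h01, hsec⟩ := hdom.exists_wide_section (hwide _ hx)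
    exact hf.exists_isHorizontalGerm hdom.isOpen ha h01 hsec
  refine ⟨horizontalContinuation R f, fun x hx => ?_, fun x hx => ?_, fun x hx hna => ?_⟩
  · have ha := hf.analytic x hx
    have h : IsHorizontalGerm R f x f :=
      ⟨x.re, hx, by simpa using ha.meromorphicAt, Filter.EventuallyEq.rfl,
        le_trans (by decide) ha.meromorphicOrderAt_nonneg⟩
    rw [h.horizontalContinuation_eq (hdom.ordConnected_section _) hf.analytic,
      toMeromorphicNFAt_eq_self.2 ha.meromorphicNFAt]
  · obtain ⟨F, hF⟩ := hgerm x hx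
    have heq := hF.horizontalContinuation_eventuallyEq hdom.ordConnected_section hdom.isOpen
      hf.analytic
    exact meromorphicNFAt_toMeromorphicNFAt.meromorphicAt.congr
      (heq.symm.filter_mono nhdsWithin_le_nhds)
  · obtain ⟨F, hF⟩ := hgerm x hx
    have heq := hF.horizontalContinuation_eventuallyEq hdom.ordConnected_section hdom.isOpen
      hf.analytic
    -- In normal form a point of non-analyticity is a genuine pole and never just a wrong value, so
    -- its order is negative.
    have hNF : MeromorphicNFAt (horizontalContinuation R f) x :=
      (meromorphicNFAt_congr heq).2 meromorphicNFAt_toMeromorphicNFAt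
    have hord : meromorphicOrderAt (horizontalContinuation R f) x = meromorphicOrderAt F x := by
      rw [meromorphicOrderAt_congr (heq.filter_mono nhdsWithin_le_nhds),
        hF.meromorphicAt.meromorphicOrderAt_toMeromorphicNFAt]
    have hlt : meromorphicOrderAt (horizontalContinuation R f) x < 0 := by
      rwa [← not_le, hNF.meromorphicOrderAt_nonneg_iff_analyticAt]
    obtain ⟨b, -, -, -, hge⟩ := hF
    rw [← hord] at hge
    generalize meromorphicOrderAt (horizontalContinuation R f) x = k at *
    induction k using WithTop.recTopCoe with
    | top => exact absurd hlt not_top_lt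
    | coe k =>
      have h1 : -1 ≤ k := by exact_mod_cast hge
      have h2 : k < 0 := by exact_mod_cast hlt
      exact_mod_cast (by omega : k = -1)
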